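/- **Setting.** Let $\theta\sim\mathbb P^N$ be a random parameter and, given $\theta$, let $\xi\sim\mathbb P_\theta$. Let $h(x,\xi)$ be a real response, measurable in $\xi$, for $x$ in an open set $\mathcal X\subseteq\mathbb R$, and let $d(x,\xi)=\partial_x h(x,\xi)$ (measurable in $\xi$), $H(x;\theta)=\mathbb E_{\mathbb P_\theta}[h(x,\xi)]$, $D(x;\theta)=\partial_x H(x;\theta)$, $F(t;x)=P(H(x;\theta)\le t)$. For $\alpha\in(0,1)$ let $v_\alpha(x)=\inf\{t: F(t;x)\ge\alpha\}$. For $\xi_1(\theta),\dots,\xi_m(\theta)$ i.i.d. from $\mathbb P_\theta$ given $\theta$, put $\hat H^m(x;\theta)=\frac1m\sum_{j\le m} h(x,\xi_j(\theta))$, $\hat D^m(x;\theta)=\frac1m\sum_{j\le m} d(x,\xi_j(\theta))$ and $\bar{\mathcal E}^m(x;\theta)=\sqrt m\,\bigl(\hat H^m(x;\theta)-H(x;\theta)\bigr)$. For $n$ independent copies $\theta_1,\dots,\theta_n$ of $\theta$ with independent inner samples, let $\hat\theta^m_{(1)},\dots,\hat\theta^m_{(n)}$ be the ordering with $\hat H^m(x;\hat\theta^m_{(1)})\le\dots\le\hat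 H^m(x;\hat\theta^m_{(n)})$ (ties broken by the index), and let $$\varphi^{n,m}_\alpha(x)=\hat D^m\bigl(x;\hat\theta^m_{(\lceil\alpha n\rceil)}\bigr).$$ **Assumptions.** Fix $x\in\mathcal X$. 1. For every $y\in\mathcal X$: $\mathbb E_{\mathbb P_\theta}[h(y,\xi)^2]<\infty$ for $\mathbb P^N$-a.e. $\theta$, and $\mathbb E_{\theta,\mathbb P_\theta}[h(y,\xi)^2]<\infty$; for every $m\ge1$ the pair $(H(y;\theta),\bar{\mathcal E}^m(y;\theta))$ has a joint density $p_m(u,e)$ that is twice differentiable in $u$ at all $(u,e)$; and there are non-negative measurable $g_{0,m},g_{1,m},g_{2,m}$ with $|\partial_u^i p_m(u,e)|\le g_{i,m}(e)$ for all $(u,e)$ and $\sup_{m\ge1}\int|e|^r g_{i,m}(e)\,de<\infty$ for $i=0,1,2$ and $0\le r\le4$. 2. There is $K$ with $K(\xi)$ integrable under $\theta\sim\mathbb P^N,\ \xi\sim\mathbb P_\theta$ such that for $\mathbb P^N$-a.e. $\theta$: $|h(x_2,\xi)-h(x_1,\xi)|\le K(\xi)|x_2-x_1|$ $\mathbb P_\theta$-a.s.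 for all $x_1,x_2\in\mathcal X$, and $d(y,\xi)$ exists $\mathbb P_\theta$-a.s. for all $y\in\mathcal X$. 3. For every $y\in\mathcal X$, $H(y;\theta)$ has a continuous density $f(t;y)$ for $t$ in a neighbourhood of $v_\alpha(y)$, and $\partial_yF(t;y)$ exists near, and is jointly continuous at, the point $(v_\alpha(y),y)$. Moreover $f(v_\alpha(x);x)>0$. 4. There are $\eta>0$, measures $G_m$ on $\mathbb R$, and regular versions $\nu(\cdot;t)$ of the conditional law of $D(x;\theta)$ given $H(x;\theta)=t$ and $\hat\nu^m(\cdot;t)$ of that of $\hat D^m(x;\theta)$ given $\hat H^m(x;\theta)=t$ such that $|\nu(B;t)-\hat\nu^m(B;t)|\le G_m(B)$ for all $m\ge1$, all $t$ with $|t-v_\alpha(x)|<\eta$ and all Borel $B\subseteq\mathbb R$, and $\int_{\mathbb R}|y|\,G_m(dy)\to0$ as $m\to\infty$. 5. $\sup_\theta\mathbb E_{\mathbb P_\theta}[d(x,\xi)^2]<\infty$ (the supremum may be taken outside a $\mathbb P^N$-null set). **Statement.** Under these assumptions $v_\alpha$ is differentiable at $x$, $\varphi^{n,m}_\alpha(x)$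 is integrable for all $n,m\ge1$, and $$\mathbb E_{\theta,\mathbb P_\theta}[\varphi^{n,m}_\alpha(x)]-v_\alpha'(x)\to0\qquad\text{as } n,m\to\infty .$$ If in addition $\int_{\mathbb R}|y|\,G_m(dy)=\mathcal O(m^{-1/2})$ and some version of $t\mapsto g(t;x)=\mathbb E_\theta[D(x;\theta)\mid H(x;\theta)=t]$ is differentiable at $t=v_\alpha(x)$, then for all budget sequences $n,m\to\infty$ with $n=\Theta(m)$, $$\mathbb E_{\theta,\mathbb P_\theta}[\varphi^{n,m}_\alpha(x)]-v_\alpha'(x)=\mathcal O(n^{-1/2}).$$ -/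

import Mathlib

open MeasureTheory ProbabilityTheory Filter Topology Asymptotics
open scoped ENNReal

noncomputable section

namespace NestedVaR

variable {Θ Ξ : Type*} [MeasurableSpace Θ] [MeasurableSpace Ξ]

/-! ### The model

`μ` is the posterior law of the parameter `θ`, `κ θ` is the law of the noise `ξ` under the
parameter `θ`, and `h x ξ` is the response at the decision `x`. -/

/-- The objective `H(x; θ)`, the expectation of `h(x, ξ)` for `ξ ∼ P_θ`. -/
def H (κ : Kernel Θ Ξ) (h : ℝ → Ξ → ℝ) (x : ℝ) (θ : Θ) : ℝ := ∫ ξ, h x ξ ∂(κ θ)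

/-- The sample path gradient `d(x, ξ)`, the derivative of `h(·, ξ)` at `x`. -/
def d (h : ℝ → Ξ → ℝ) (x : ℝ) (ξ : Ξ) : ℝ := deriv (fun y => h y ξ) x

/-- The gradient `D(x; θ)`, the derivative of `H(·; θ)` at `x`. -/
def D (κ : Kernel Θ Ξ) (h : ℝ → Ξ → ℝ) (x : ℝ) (θ : Θ) : ℝ := deriv (fun y => H κ h y θ) x

/-- The distribution function `F(t; x)` of `H(x; θ)`, `θ ∼ μ`. -/
def F (μ : Measure Θ) (κ : Kernel Θ Ξ) (h : ℝ → Ξ → ℝ) (t x : ℝ) : ℝ :=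
  μ.real {θ | H κ h x θ ≤ t}

/-- Value-at-Risk, `v_α(x) = inf {t : P(H(x; θ) ≤ t) ≥ α}`. -/
def VaR (μ : Measure Θ) (κ : Kernel Θ Ξ) (h : ℝ → Ξ → ℝ) (α x : ℝ) : ℝ :=
  sInf {t : ℝ | α ≤ F μ κ h t x}

/-! ### Sampling -/

/-- The kernel `θ ↦ P_θ^{⊗ m}`: conditionally on `θ`, `m` i.i.d. draws from `P_θ`. -/
def innerKernel (κ : Kernel Θ Ξ) [IsMarkovKernel κ] (m : ℕ) : Kernel Θ (Fin m → Ξ) where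
  toFun θ := Measure.pi (fun _ : Fin m => κ θ)
  measurable' := by
    refine Measurable.measure_of_isPiSystem_of_isProbabilityMeasure
      generateFrom_pi.symm isPiSystem_pi ?_
    rintro s ⟨t, ht, rfl⟩
    simp only [Measure.pi_pi]
    refine Finset.measurable_prod _ fun i _ => ?_
    exact Kernel.measurable_coe κ (ht i (Set.mem_univ i))

instance (κ : Kernel Θ Ξ) [IsMarkovKernel κ] (m : ℕ) : IsMarkovKernel (innerKernel κ m) :=
  ⟨fun θ => inferInstanceAs (IsProbabilityMeasure (Measure.pi (fun _ : Fin m => κ θ)))⟩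

/-- The joint law of `(θ, (ξ_1(θ), …, ξ_m(θ)))`. -/
def pairLaw (μ : Measure Θ) (κ : Kernel Θ Ξ) [IsMarkovKernel κ] (m : ℕ) :
    Measure (Θ × (Fin m → Ξ)) :=
  μ ⊗ₘ innerKernel κ m

/-- The law of the whole nested sample: `n` i.i.d. copies of `(θ, (ξ_1(θ), …, ξ_m(θ)))`. -/
def sampleLaw (μ : Measure Θ) (κ : Kernel Θ Ξ) [IsMarkovKernel κ] (n m : ℕ) :
    Measure (Fin n → Θ × (Fin m → Ξ)) :=
  Measure.pi (fun _ : Fin n => pairLaw μ κ m)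

/-- The inner estimator `Ĥ^m(x; θ)`, as a function of the inner sample. -/
def Hhat (h : ℝ → Ξ → ℝ) (x : ℝ) {m : ℕ} (ξ : Fin m → Ξ) : ℝ := (1 / (m : ℝ)) * ∑ j, h x (ξ j)

/-- The inner gradient estimator `D̂^m(x; θ)`, as a function of the inner sample. -/
def Dhat (h : ℝ → Ξ → ℝ) (x : ℝ) {m : ℕ} (ξ : Fin m → Ξ) : ℝ := (1 / (m : ℝ)) * ∑ j, d h x (ξ j)

/-- The normalized estimation error `√m · (1/m) ∑ⱼ (h(x, ξⱼ(θ)) - H(x; θ))`. -/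
def normErr (κ : Kernel Θ Ξ) (h : ℝ → Ξ → ℝ) (x : ℝ) {m : ℕ} (ω : Θ × (Fin m → Ξ)) : ℝ :=
  √(m : ℝ) * ((1 / (m : ℝ)) * ∑ j, (h x (ω.2 j) - H κ h x ω.1))

/-- The nested VaR-gradient estimator `φ^{n,m}_α(x)`: the outer samples are sorted by their value of
`Ĥ^m` (`Tuple.sort` breaks ties by the index), and `D̂^m` is evaluated at the one of rank `⌈α n⌉`.
For `0 < α < 1` and `n ≥ 1` the rank lies in `{1, …, n}`; the value `0` is used only for `n = 0`. -/
def phi (h : ℝ → Ξ → ℝ) (α x : ℝ) (n m : ℕ) (ω : Fin n → Θ × (Fin m → Ξ)) : ℝ :=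
  if hk : ⌈α * n⌉₊ - 1 < n then
    Dhat h x (ω (Tuple.sort (fun i => Hhat h x (ω i).2) ⟨⌈α * n⌉₊ - 1, hk⟩)).2
  else 0

/-- The expectation of `φ^{n,m}_α(x)` over the nested sample. -/
def meanPhi (μ : Measure Θ) (κ : Kernel Θ Ξ) [IsMarkovKernel κ] (h : ℝ → Ξ → ℝ) (α x : ℝ)
    (n m : ℕ) : ℝ :=
  ∫ ω, phi h α x n m ω ∂(sampleLaw μ κ n m)

/-! ### Conditional laws and conditional expectations given a value -/

/-- `ν(·; t)` is a (regular) version of the conditional law of `Y` given `X = t`. -/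
def IsCondLaw {Ω : Type*} [MeasurableSpace Ω] (P : Measure Ω) (Y X : Ω → ℝ)
    (ν : Kernel ℝ ℝ) : Prop :=
  IsMarkovKernel ν ∧ P.map (fun ω => (X ω, Y ω)) = P.map X ⊗ₘ ν

/-- `g` is a version of the function `t ↦ E[D(x; θ) | H(x; θ) = t]`. -/
def IsCondMean (μ : Measure Θ) (κ : Kernel Θ Ξ) (h : ℝ → Ξ → ℝ) (x : ℝ) (g : ℝ → ℝ) : Prop :=
  Measurable g ∧
    (fun θ => g (H κ h x θ)) =ᵐ[μ]
      μ[D κ h x | MeasurableSpace.comap (H κ h x) inferInstance]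

/-! ### Assumptions -/

/-- Finite second moments of the response, and, for every `m ≥ 1`, a joint density `p m` of
`H(x; θ)` and of the normalized error that is twice differentiable in its first argument, with
dominating functions whose absolute moments up to order four are bounded in `m`. -/
def MomentDensityAssumption (μ : Measure Θ) (κ : Kernel Θ Ξ) [IsMarkovKernel κ]
    (h : ℝ → Ξ → ℝ) (𝒳 : Set ℝ) : Prop :=
  ∀ x ∈ 𝒳,
    (∀ᵐ θ ∂μ, MemLp (h x) 2 (κ θ)) ∧ MemLp (h x) 2 (μ.bind κ) ∧
    ∃ p : ℕ → ℝ → ℝ → ℝ, ∃ g₀ g₁ g₂ : ℕ → ℝ → ℝ,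
      (∀ m, 1 ≤ m →
        Measurable (Function.uncurry (p m)) ∧
        (∀ u e, 0 ≤ p m u e) ∧
        (pairLaw μ κ m).map (fun ω => (H κ h x ω.1, normErr κ h x ω)) =
          (volume : Measure (ℝ × ℝ)).withDensity (fun z => ENNReal.ofReal (p m z.1 z.2)) ∧
        (∀ u e, DifferentiableAt ℝ (fun s => p m s e) u) ∧
        (∀ u e, DifferentiableAt ℝ (deriv (fun s => p m s e)) u) ∧
        Measurable (g₀ m) ∧ Measurable (g₁ m) ∧ Measurable (g₂ m) ∧
        (∀ e, 0 ≤ g₀ m e ∧ 0 ≤ g₁ m e ∧ 0 ≤ g₂ m e) ∧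
        (∀ u e, p m u e ≤ g₀ m e ∧ |deriv (fun s => p m s e) u| ≤ g₁ m e ∧
          |deriv (deriv (fun s => p m s e)) u| ≤ g₂ m e)) ∧
      ∀ r : ℝ, 0 ≤ r → r ≤ 4 → ∃ C : ℝ, ∀ m, 1 ≤ m →
        ∫⁻ e, ENNReal.ofReal (|e| ^ r * g₀ m e) ≤ ENNReal.ofReal C ∧
        ∫⁻ e, ENNReal.ofReal (|e| ^ r * g₁ m e) ≤ ENNReal.ofReal C ∧
        ∫⁻ e, ENNReal.ofReal (|e| ^ r * g₂ m e) ≤ ENNReal.ofReal C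

/-- The response is Lipschitz in `x` with an integrable random constant `K(ξ)`, and it is almost
surely differentiable at each `x`. Here `μ.bind κ` is the law of `ξ` when `θ ∼ μ`, `ξ ∼ P_θ`. -/
def InterchangeAssumption (μ : Measure Θ) (κ : Kernel Θ Ξ) (h : ℝ → Ξ → ℝ) (𝒳 : Set ℝ) : Prop :=
  ∃ K : Ξ → ℝ, Integrable K (μ.bind κ) ∧
    ∀ᵐ θ ∂μ,
      (∀ x₁ ∈ 𝒳, ∀ x₂ ∈ 𝒳, ∀ᵐ ξ ∂(κ θ), |h x₂ ξ - h x₁ ξ| ≤ K ξ * |x₂ - x₁|) ∧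
      (∀ x ∈ 𝒳, ∀ᵐ ξ ∂(κ θ), DifferentiableAt ℝ (fun y => h y ξ) x)

/-- For every `x ∈ 𝒳`, `H(x; θ)` has the continuous density `f(·; x)` in a neighbourhood of
`v_α(x)`, and `∂ₓF` exists near `(v_α(x), x)` and is jointly continuous at that point. -/
def LocalDensityAssumption (μ : Measure Θ) (κ : Kernel Θ Ξ) (h : ℝ → Ξ → ℝ) (α : ℝ) (𝒳 : Set ℝ)
    (f : ℝ → ℝ → ℝ) : Prop :=
  ∀ x ∈ 𝒳,
    (∃ δ : ℝ, 0 < δ ∧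
      ContinuousOn (fun t => f t x) (Metric.ball (VaR μ κ h α x) δ) ∧
      (∀ t ∈ Metric.ball (VaR μ κ h α x) δ, 0 ≤ f t x) ∧
      (μ.map (H κ h x)).restrict (Metric.ball (VaR μ κ h α x) δ) =
        (volume.restrict (Metric.ball (VaR μ κ h α x) δ)).withDensity
          (fun t => ENNReal.ofReal (f t x))) ∧
    (∀ᶠ z : ℝ × ℝ in 𝓝 (VaR μ κ h α x, x), DifferentiableAt ℝ (fun y => F μ κ h z.1 y) z.2) ∧
    ContinuousAt (fun z : ℝ × ℝ => deriv (fun y => F μ κ h z.1 y) z.2) (VaR μ κ h α x, x)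

/-- The measure-perturbation integral `∫ |y| G(dy)`. -/
def absMoment (G : Measure ℝ) : ℝ≥0∞ := ∫⁻ y, ENNReal.ofReal |y| ∂G

/-- For `t` in a ball around `v_α(x)`, the conditional law `ν(·; t)` of `D(x; θ)` given
`H(x; θ) = t` and the conditional law `ν̂^m(·; t)` of `D̂^m` given `Ĥ^m = t` differ on every Borel
set by at most the measure `G m`, and `∫ |y| G_m(dy) → 0`. -/
def MeasureAssumption (μ : Measure Θ) (κ : Kernel Θ Ξ) [IsMarkovKernel κ] (h : ℝ → Ξ → ℝ)
    (α x : ℝ) (G : ℕ → Measure ℝ) : Prop :=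
  (∃ η : ℝ, 0 < η ∧ ∃ (ν : Kernel ℝ ℝ) (νhat : ℕ → Kernel ℝ ℝ),
    IsCondLaw μ (D κ h x) (H κ h x) ν ∧
    (∀ m, 1 ≤ m →
      IsCondLaw (pairLaw μ κ m) (fun ω => Dhat h x ω.2) (fun ω => Hhat h x ω.2) (νhat m)) ∧
    ∀ m, 1 ≤ m → ∀ t ∈ Metric.ball (VaR μ κ h α x) η, ∀ B : Set ℝ, MeasurableSet B →
      ENNReal.ofReal |(ν t).real B - (νhat m t).real B| ≤ G m B) ∧
  Tendsto (fun m => absMoment (G m)) atTop (𝓝 0)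

/-- `sup_θ E_θ[d(x, ξ)²] < ∞`, the supremum being taken up to a `μ`-null set of parameters (on which
`d(x, ξ)` need not exist). -/
def SupremumAssumption (μ : Measure Θ) (κ : Kernel Θ Ξ) (h : ℝ → Ξ → ℝ) (x : ℝ) : Prop :=
  ∃ C : ℝ, ∀ᵐ θ ∂μ, ∫⁻ ξ, ENNReal.ofReal (d h x ξ ^ 2) ∂(κ θ) ≤ ENNReal.ofReal C

end NestedVaR

end

open MeasureTheory ProbabilityTheory Filter Topology Asymptotics
open scoped ENNReal

noncomputable section

namespace NestedVaR

/-! ### Order statistics of an i.i.d. sample -/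

section OrderStatistics

/-! Both $v_\alpha'(x)$ and the limit of the estimator are identified with
$w=-\partial_xF(v;x)/f(v;x)$, where $v=v_\alpha(x)$.

For the quantile, $F(v_\alpha(y);y)=\alpha$ near $x$, and an implicit function argument gives
$v_\alpha'(x)=w$ (`hasDerivAt_quantile`, `hasDerivAt_VaR`). It has to work with $F(\cdot\,;x)$
differentiable only at $v$ and with continuity of $\partial_yF$ at one point only.

For the gradient, let $\chi$ be a continuous test function supported near $v$ and $\psi$ an
antiderivative of it. Differentiating $\mathbb E\,\psi(H(y;\theta))$ under the expectation gives
$\mathbb E[\chi(H)D]$. Rewriting it first as $\int\chi(t)(1-F(t;y))\,dt$ gives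
$-\int\chi\,\partial_yF\,dt$. Hence every version of $E[D\mid H=t]$ equals $-\partial_xF/f$ for a.e.
$t$ near $v$ (`integral_comp_H_mul_D_eq`, `ae_mul_density_eq_of_isRegression`).

The estimator is the concomitant of an order statistic: $X=\hat H^m$ is sorted and $Y=\hat D^m$ is
read off at the selected index. The index depends on the $X$-values only, so $Y$ may be replaced in
mean by its regression function $\gamma_m(X)$ (`integral_orderStat_concomitant_eq_zero`). Near $v$,
$\gamma_m$ is within $\int|y|\,dG_m$ of $E[D\mid H=\cdot]$ (`abs_integral_sub_integral_le`), hence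
close to $w$. The order statistic concentrates at $v$ by Hoeffding's inequality: the distribution
function of $\hat H^m$ is within $O(m^{-1/2})$ of $F$, and $F$ crosses $\alpha$ with positive slope
(`measureReal_lt_abs_orderStat_sub_le`). Away from $v$ the second moment of $Y$ at the selected
index is bounded only up to a factor $n$, which the exponentially small probability outweighs.

All this is collected in `exists_abs_meanPhi_sub_le`. Continuity of $-\partial_xF/f$ at $v$ then
yields convergence, and a linear bound at $v$ yields the rate. -/

/-- Sorting permutes the sample and so preserves the number of points below $t$. This turns events
about an order statistic into events about a sum of i.i.d. indicators. The rank $j$ counts from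
zero, whence the strict inequality. -/
theorem apply_sort_le_iff {n : ℕ} (x : Fin n → ℝ) (j : Fin n) (t : ℝ) :
    x (Tuple.sort x j) ≤ t ↔ (j : ℕ) < (Finset.univ.filter fun i => x i ≤ t).card := by
  have h := Tuple.lt_card_le_iff_apply_le_of_monotone (j := j) (a := t) (Tuple.monotone_sort x)
  rw [Function.comp_apply] at h
  rw [← h]
  have : (Finset.univ.filter fun i => (x ∘ Tuple.sort x) i ≤ t).card
      = (Finset.univ.filter fun i => x i ≤ t).card := by
    refine Finset.card_bij (fun i _ => Tuple.sort x i) ?_ ?_ ?_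
    · intro i hi; simpa using hi
    · intro i _ k _ hik; simpa using hik
    · intro i hi
      exact ⟨(Tuple.sort x).symm i, by simpa using hi, by simp⟩
  rw [this]

/-- The sorting permutation is characterised by finitely many comparisons of coordinates:
monotonicity, and increasing indices among ties. -/
theorem measurableSet_sort_eq {n : ℕ} (σ : Equiv.Perm (Fin n)) :
    MeasurableSet {x : Fin n → ℝ | Tuple.sort x = σ} := by
  have : {x : Fin n → ℝ | Tuple.sort x = σ} =
      (⋂ i, ⋂ j, ⋂ (_ : i ≤ j), {x : Fin n → ℝ | x (σ i) ≤ x (σ j)}) ∩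
      (⋂ i, ⋂ j, ⋂ (_ : i < j), {x : Fin n → ℝ | x (σ i) = x (σ j) → σ i < σ j}) := by
    ext x
    simp only [Set.mem_ofPred_eq, Set.mem_inter_iff, Set.mem_iInter]
    rw [eq_comm, Tuple.eq_sort_iff]
    rfl
  rw [this]
  refine MeasurableSet.inter ?_ ?_
  · refine MeasurableSet.iInter fun i => MeasurableSet.iInter fun j => MeasurableSet.iInter fun _ => ?_
    exact measurableSet_le (measurable_pi_apply _) (measurable_pi_apply _)
  · refine MeasurableSet.iInter fun i => MeasurableSet.iInter fun j => MeasurableSet.iInter fun _ => ?_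
    by_cases h : σ i < σ j
    · simp [h]
    · simp only [h, imp_false]
      exact (measurableSet_eq_fun (f := fun x : Fin n → ℝ => x (σ i))
        (g := fun x : Fin n → ℝ => x (σ j)) (measurable_pi_apply _) (measurable_pi_apply _)).compl

theorem measurable_sort_apply {n : ℕ} (j : Fin n) :
    Measurable (fun x : Fin n → ℝ => Tuple.sort x j) := by
  refine measurable_to_countable' fun i => ?_
  have : (fun x : Fin n → ℝ => Tuple.sort x j) ⁻¹' {i} =
      ⋃ σ : Equiv.Perm (Fin n), ⋃ (_ : σ j = i), {x : Fin n → ℝ | Tuple.sort x = σ} := by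
    ext x
    simp
  rw [this]
  exact MeasurableSet.iUnion fun σ => MeasurableSet.iUnion fun _ => measurableSet_sort_eq σ

variable {Ω : Type*} [MeasurableSpace Ω]

/-- Hoeffding's inequality for the number of sample points that fall into a set. -/
theorem measureReal_pi_le_sum_indicator_le (P : Measure Ω) [IsProbabilityMeasure P] {s : Set Ω}
    (hs : MeasurableSet s) {n : ℕ} (hn : 1 ≤ n) {δ : ℝ} (hδ : 0 ≤ δ) :
    (Measure.pi fun _ : Fin n => P).real
      {ω | n * (P.real s + δ) ≤ ∑ i, s.indicator (fun _ => (1 : ℝ)) (ω i)}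
      ≤ Real.exp (-2 * n * δ ^ 2) := by
  have hn' : (0 : ℝ) < n := by exact_mod_cast hn
  set f : Ω → ℝ := s.indicator fun _ => (1 : ℝ) with hf
  have hfm : Measurable f := measurable_const.indicator hs
  have hf01 : ∀ ω, f ω ∈ Set.Icc (0 : ℝ) 1 := by
    intro ω
    by_cases h : ω ∈ s <;> simp [hf, h]
  have hint : ∫ ω, f ω ∂P = P.real s := by
    rw [hf, integral_indicator hs]; simp
  -- A $[0,1]$-valued variable has variance proxy $1/4$; the sum then has proxy $n/4$, and the
  -- exponent is $(n\delta)^2/(2\cdot n/4)=2n\delta^2$.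
  have hsub : HasSubgaussianMGF (fun ω => f ω - P.real s) ((‖(1 : ℝ) - 0‖₊ / 2) ^ 2) P := by
    have := hasSubgaussianMGF_of_mem_Icc (μ := P) hfm.aemeasurable (Filter.Eventually.of_forall hf01)
    rwa [hint] at this
  have hind : iIndepFun (fun (i : Fin n) (ω : Fin n → Ω) => f (ω i) - P.real s)
      (Measure.pi fun _ : Fin n => P) :=
    iIndepFun_pi (X := fun _ ω => f ω - P.real s)
      fun _ => (hfm.sub_const _).aemeasurable
  have key := HasSubgaussianMGF.measure_sum_ge_le_of_iIndepFun hind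
    (c := fun _ => (‖(1 : ℝ) - 0‖₊ / 2) ^ 2) (s := Finset.univ) (fun i _ => by
      refine HasSubgaussianMGF.of_map (X := fun ω => f ω - P.real s)
        (Y := fun ω : Fin n → Ω => ω i) (measurable_pi_apply i).aemeasurable ?_
      rw [(measurePreserving_eval (fun _ : Fin n => P) i).map_eq]
      exact hsub) (ε := n * δ) (by positivity)
  refine le_trans (le_of_eq ?_) (key.trans (le_of_eq ?_))
  · congr 1
    ext ω
    simp only [Set.mem_ofPred_eq, Finset.sum_sub_distrib, Finset.sum_const, Finset.card_univ,
      Fintype.card_fin, nsmul_eq_mul]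
    constructor <;> intro h <;> linarith
  · congr 1
    simp
    field_simp

/-- On this event at least $j+1\ge\alpha n$ sample points lie in $\{X\le t\}$, although the expected
number is at most $n(\alpha-\delta)$. -/
theorem measureReal_orderStat_le_le (P : Measure Ω) [IsProbabilityMeasure P] {X : Ω → ℝ}
    (hX : Measurable X) {n : ℕ} (j : Fin n) {α δ t : ℝ} (hδ : 0 ≤ δ)
    (hj : α * n ≤ (j : ℕ) + 1) (ht : P.real {ω | X ω ≤ t} ≤ α - δ) :
    (Measure.pi fun _ : Fin n => P).real
      {ω | X (ω (Tuple.sort (fun i => X (ω i)) j)) ≤ t} ≤ Real.exp (-2 * n * δ ^ 2) := by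
  have hn : 1 ≤ n := j.pos
  have hn' : (0 : ℝ) < n := by exact_mod_cast hn
  have hm : MeasurableSet {ω | X ω ≤ t} := hX measurableSet_Iic
  refine le_trans (measureReal_mono ?_) (measureReal_pi_le_sum_indicator_le P hm hn hδ)
  intro ω hω
  have := (apply_sort_le_iff (fun i => X (ω i)) j t).1 hω
  have h1 : ∑ i, Set.indicator {ω | X ω ≤ t} (fun _ => (1 : ℝ)) (ω i) =
      ((Finset.univ.filter fun i => X (ω i) ≤ t).card : ℝ) := by
    simp [Set.indicator_apply]
  have h2 : ((j : ℕ) : ℝ) + 1 ≤ ((Finset.univ.filter fun i => X (ω i) ≤ t).card : ℝ) := by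
    exact_mod_cast this
  simp only [Set.mem_ofPred_eq]
  rw [h1]
  nlinarith

/-- The mirror image: at most $j\le\alpha n$ points lie below $t$, so the complement of $\{X\le t\}$
is hit too often. -/
theorem measureReal_lt_orderStat_le (P : Measure Ω) [IsProbabilityMeasure P] {X : Ω → ℝ}
    (hX : Measurable X) {n : ℕ} (j : Fin n) {α δ t : ℝ} (hδ : 0 ≤ δ)
    (hj : (j : ℕ) ≤ α * n) (ht : α + δ ≤ P.real {ω | X ω ≤ t}) :
    (Measure.pi fun _ : Fin n => P).real
      {ω | t < X (ω (Tuple.sort (fun i => X (ω i)) j))} ≤ Real.exp (-2 * n * δ ^ 2) := by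
  have hn : 1 ≤ n := j.pos
  have hn' : (0 : ℝ) < n := by exact_mod_cast hn
  have hm : MeasurableSet {ω | X ω ≤ t} := hX measurableSet_Iic
  refine le_trans (measureReal_mono ?_)
    (measureReal_pi_le_sum_indicator_le P hm.compl hn hδ)
  intro ω hω
  have := (apply_sort_le_iff (fun i => X (ω i)) j t).not.1 (not_le.2 hω)
  have h1 : ∑ i, Set.indicator {ω | X ω ≤ t}ᶜ (fun _ => (1 : ℝ)) (ω i) =
      n - ((Finset.univ.filter fun i => X (ω i) ≤ t).card : ℝ) := by
    rw [eq_sub_iff_add_eq]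
    simp only [Set.indicator_compl, Pi.sub_apply, Finset.sum_sub_distrib]
    simp [Set.indicator_apply]
  have h2 : ((Finset.univ.filter fun i => X (ω i) ≤ t).card : ℝ) ≤ (j : ℕ) := by
    exact_mod_cast not_lt.1 this
  simp only [Set.mem_ofPred_eq]
  rw [h1, probReal_compl_eq_one_sub hm]
  nlinarith

theorem measurable_orderStat_concomitant {X Y : Ω → ℝ} (hX : Measurable X) (hY : Measurable Y)
    {n : ℕ} (j : Fin n) :
    Measurable fun ω : Fin n → Ω => Y (ω (Tuple.sort (fun i => X (ω i)) j)) := by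
  have h1 : Measurable fun ω : Fin n → Ω => Tuple.sort (fun i => X (ω i)) j :=
    (measurable_sort_apply j).comp
      (measurable_pi_lambda _ fun i => hX.comp (measurable_pi_apply i))
  have h2 : Measurable fun p : (Fin n → Ω) × Fin n => Y (p.1 p.2) :=
    measurable_from_prod_countable_left fun i => hY.comp (measurable_pi_apply i)
  exact h2.comp (measurable_id.prodMk h1)

/-- A function of one sample point whose conditional mean given `X` vanishes is uncorrelated with
every function of the values of `X` on the sample. -/
theorem integral_pi_mul_eq_zero (P : Measure Ω) [IsProbabilityMeasure P] {X Z : Ω → ℝ}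
    (hX : Measurable X) (hZ : Integrable Z P)
    (h0 : ∀ c : ℝ → ℝ, Measurable c → (∃ M, ∀ t, |c t| ≤ M) → ∫ ω, c (X ω) * Z ω ∂P = 0)
    {n : ℕ} (i : Fin n) {Φ : (Fin n → ℝ) → ℝ} (hΦ : Measurable Φ) (hΦb : ∃ M, ∀ x, |Φ x| ≤ M) :
    ∫ ω, Φ (fun k => X (ω k)) * Z (ω i) ∂(Measure.pi fun _ : Fin n => P) = 0 := by
  obtain ⟨M, hM⟩ := hΦb
  cases n with
  | zero => exact i.elim0
  | succ n =>
    have mp := measurePreserving_piFinSuccAbove (fun _ : Fin (n + 1) => P) i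
    have mps := mp.symm
    rw [← mps.integral_comp']
    have hint0 : Integrable (fun ω : Fin (n + 1) → Ω => Φ (fun k => X (ω k)) * Z (ω i))
        (Measure.pi fun _ : Fin (n + 1) => P) := by
      refine Integrable.bdd_mul (c := M) ?_ ?_ ?_
      · exact (measurePreserving_eval (fun _ : Fin (n + 1) => P) i).integrable_comp_of_integrable hZ
      · exact (hΦ.comp (measurable_pi_lambda _ fun i =>
          hX.comp (measurable_pi_apply i))).aestronglyMeasurable
      · exact Eventually.of_forall fun ω => hM _
    have hint := mps.integrable_comp_of_integrable hint0
    -- With all sample points but the $i$-th frozen, $\Phi$ is a bounded function of $X(\omega_i)$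
    -- alone, and `h0` makes the inner integral vanish.
    refine (integral_prod_symm _ hint).trans ?_
    refine integral_eq_zero_of_ae (Eventually.of_forall fun y => ?_)
    have := h0 (fun t => Φ (Fin.insertNth (α := fun _ => ℝ) i t fun k => X (y k)))
      (hΦ.comp (by
        refine measurable_pi_lambda _ fun k => ?_
        refine Fin.succAboveCases i ?_ (fun k => ?_) k <;> simp [measurable_id']))
      ⟨M, fun t => hM _⟩
    refine Eq.trans ?_ this
    refine integral_congr_ae (Eventually.of_forall fun ω => ?_)
    simp only [Function.comp_apply, MeasurableEquiv.piFinSuccAbove_symm_apply, Fin.insertNthEquiv, Equiv.coe_fn_mk,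
      Fin.insertNth_apply_same]
    congr 2
    ext k
    refine Fin.succAboveCases i ?_ (fun k => ?_) k <;> simp

/-- Split according to the selected index. The indicator that it equals $i$ is a function of the
$X$-values only, hence uncorrelated with $Z(\omega_i)$. -/
theorem integral_orderStat_concomitant_eq_zero (P : Measure Ω) [IsProbabilityMeasure P]
    {X Z : Ω → ℝ} (hX : Measurable X) (hZ : Integrable Z P)
    (h0 : ∀ c : ℝ → ℝ, Measurable c → (∃ M, ∀ t, |c t| ≤ M) → ∫ ω, c (X ω) * Z ω ∂P = 0)
    {n : ℕ} (j : Fin n) :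
    ∫ ω, Z (ω (Tuple.sort (fun i => X (ω i)) j)) ∂(Measure.pi fun _ : Fin n => P) = 0 := by
  have h : ∀ ω : Fin n → Ω, Z (ω (Tuple.sort (fun i => X (ω i)) j)) =
      ∑ i, (if Tuple.sort (fun i => X (ω i)) j = i then (1 : ℝ) else 0) * Z (ω i) := by
    intro ω; simp
  have hm : ∀ i : Fin n, Measurable
      fun x : Fin n → ℝ => if Tuple.sort x j = i then (1 : ℝ) else 0 := fun i =>
    Measurable.ite (measurable_sort_apply j (measurableSet_singleton i)) measurable_const
      measurable_const
  have hb : ∀ (i : Fin n) (x : Fin n → ℝ), |if Tuple.sort x j = i then (1 : ℝ) else 0| ≤ 1 := by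
    intro i x; split_ifs <;> simp
  simp_rw [h]
  rw [integral_finsetSum]
  · exact Finset.sum_eq_zero fun i _ =>
      integral_pi_mul_eq_zero P hX hZ h0 i (hm i) ⟨1, hb i⟩
  · intro i _
    refine Integrable.bdd_mul (c := 1) ?_ ?_ ?_
    · exact (measurePreserving_eval (fun _ : Fin n => P) i).integrable_comp_of_integrable hZ
    · exact ((hm i).comp (measurable_pi_lambda _ fun i =>
          hX.comp (measurable_pi_apply i))).aestronglyMeasurable
    · exact Eventually.of_forall fun ω => hb i _

theorem integrable_orderStat_concomitant (P : Measure Ω) [IsProbabilityMeasure P]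
    {X Y : Ω → ℝ} (hX : Measurable X) (hYm : Measurable Y) (hY : Integrable Y P)
    {n : ℕ} (j : Fin n) :
    Integrable (fun ω => Y (ω (Tuple.sort (fun i => X (ω i)) j)))
      (Measure.pi fun _ : Fin n => P) := by
  have hi : ∀ i : Fin n, Integrable (fun ω : Fin n → Ω => |Y (ω i)|)
      (Measure.pi fun _ : Fin n => P) := fun i =>
    (measurePreserving_eval (fun _ : Fin n => P) i).integrable_comp_of_integrable hY.abs
  refine (integrable_finsetSum Finset.univ fun i _ => hi i).mono'
    (measurable_orderStat_concomitant hX hYm j).aestronglyMeasurable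
    (Eventually.of_forall fun ω => ?_)
  exact Finset.single_le_sum (f := fun i => |Y (ω i)|) (fun i _ => abs_nonneg _)
    (Finset.mem_univ _)

/-- A nonnegative selected term is at most the sum of all terms. The factor $n$ lost here is
harmless, because the bound is applied with a small coefficient. -/
theorem integral_orderStat_concomitant_le (P : Measure Ω) [IsProbabilityMeasure P]
    {X Y : Ω → ℝ} (hX : Measurable X) (hYm : Measurable Y) (hY : Integrable Y P)
    (hY0 : ∀ ω, 0 ≤ Y ω) {n : ℕ} (j : Fin n) :
    ∫ ω, Y (ω (Tuple.sort (fun i => X (ω i)) j)) ∂(Measure.pi fun _ : Fin n => P)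
      ≤ n * ∫ ω, Y ω ∂P := by
  have hi : ∀ i : Fin n, Integrable (fun ω : Fin n → Ω => Y (ω i))
      (Measure.pi fun _ : Fin n => P) := fun i =>
    (measurePreserving_eval (fun _ : Fin n => P) i).integrable_comp_of_integrable hY
  calc ∫ ω, Y (ω (Tuple.sort (fun i => X (ω i)) j)) ∂(Measure.pi fun _ : Fin n => P)
      ≤ ∫ ω, ∑ i, Y (ω i) ∂(Measure.pi fun _ : Fin n => P) := by
        refine integral_mono (integrable_orderStat_concomitant P hX hYm hY j)
          (integrable_finsetSum _ fun i _ => hi i) fun ω => ?_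
        exact Finset.single_le_sum (f := fun i => Y (ω i)) (fun i _ => hY0 _)
          (Finset.mem_univ _)
    _ = ∑ i : Fin n, ∫ ω, Y ω ∂P := by
        rw [integral_finsetSum _ fun i _ => hi i]
        refine Finset.sum_congr rfl fun i _ => ?_
        exact integral_comp_eval (μ := fun _ : Fin n => P) hYm.aestronglyMeasurable
    _ = n * ∫ ω, Y ω ∂P := by simp

end OrderStatistics

/-! ### The model -/

section Model

/-- Dominated convergence for difference quotients at $x$. Only increments from the base point are
bounded, and the exceptional null set may depend on $y$. -/
theorem hasDerivAt_integral_of_ae_lipschitz {Ω : Type*} [MeasurableSpace Ω] {P : Measure Ω}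
    {u : ℝ → Ω → ℝ} {u' K : Ω → ℝ} {x : ℝ} {s : Set ℝ} (hs : s ∈ 𝓝 x)
    (hu : ∀ y ∈ s, AEStronglyMeasurable (u y) P) (hux : Integrable (u x) P) (hK : Integrable K P)
    (hlip : ∀ y ∈ s, ∀ᵐ ω ∂P, |u y ω - u x ω| ≤ K ω * |y - x|)
    (hderiv : ∀ᵐ ω ∂P, HasDerivAt (fun y => u y ω) (u' ω) x) :
    HasDerivAt (fun y => ∫ ω, u y ω ∂P) (∫ ω, u' ω ∂P) x := by
  have hx : x ∈ s := mem_of_mem_nhds hs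
  have hint : ∀ y ∈ s, Integrable (u y) P := by
    intro y hy
    have h1 : Integrable (fun ω => u y ω - u x ω) P := by
      refine (hK.mul_const |y - x|).mono' ((hu y hy).sub (hu x hx)) ?_
      filter_upwards [hlip y hy] with ω h using h
    have h2 := h1.add hux
    refine h2.congr (Eventually.of_forall fun ω => ?_)
    simp
  rw [hasDerivAt_iff_tendsto_slope]
  have hsx : ∀ᶠ y in 𝓝[≠] x, y ∈ s := mem_nhdsWithin_of_mem_nhds hs
  have key : Tendsto (fun y => ∫ ω, slope (fun y => u y ω) x y ∂P) (𝓝[≠] x)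
      (𝓝 (∫ ω, u' ω ∂P)) := by
    refine tendsto_integral_filter_of_dominated_convergence K ?_ ?_ hK ?_
    · filter_upwards [hsx] with y hy
      simp only [slope_def_field]
      simp only [div_eq_mul_inv]
      exact ((hu y hy).sub (hu x hx)).mul_const _
    · filter_upwards [hsx, self_mem_nhdsWithin] with y hy hyx
      filter_upwards [hlip y hy] with ω h
      have hpos : 0 < |y - x| := abs_pos.2 (sub_ne_zero.2 hyx)
      rw [slope_def_field, Real.norm_eq_abs, abs_div, div_le_iff₀ hpos]
      exact h
    · filter_upwards [hderiv] with ω h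
      exact hasDerivAt_iff_tendsto_slope.1 h
  refine key.congr' ?_
  filter_upwards [hsx] with y hy
  simp only [slope_def_field]
  rw [integral_div, integral_sub (hint y hy) (hint x hx)]

variable {Θ Ξ : Type*} [MeasurableSpace Θ] [MeasurableSpace Ξ]
  {μ : Measure Θ} {κ : Kernel Θ Ξ} {h : ℝ → Ξ → ℝ} {𝒳 : Set ℝ} {x : ℝ}

theorem Hhat_eq_add {m : ℕ} (hm : 1 ≤ m) (ω : Θ × (Fin m → Ξ)) :
    Hhat h x ω.2 = H κ h x ω.1 + normErr κ h x ω / √(m : ℝ) := by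
  have hm' : (0 : ℝ) < m := by exact_mod_cast hm
  have hs : √(m : ℝ) ≠ 0 := (Real.sqrt_pos.2 hm').ne'
  unfold Hhat normErr
  rw [mul_div_cancel_left₀ _ hs, Finset.sum_sub_distrib]
  simp only [Finset.sum_const, Finset.card_univ, Fintype.card_fin, nsmul_eq_mul]
  field_simp
  ring

theorem measurable_H [IsSFiniteKernel κ] (hmeas : Measurable (h x)) : Measurable (H κ h x) :=
  (hmeas.stronglyMeasurable.integral_kernel (κ := κ)).measurable

variable [IsMarkovKernel κ]

/-- Under the interchange assumption `H` is Lipschitz in the decision, with an integrable constant,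
and may be differentiated under the expectation. -/
theorem exists_lipschitz_hasDerivAt_H (h𝒳 : IsOpen 𝒳) (hx : x ∈ 𝒳)
    (hmeas : ∀ y ∈ 𝒳, Measurable (h y)) (hL2 : ∀ᵐ θ ∂μ, MemLp (h x) 2 (κ θ))
    (h₂ : InterchangeAssumption μ κ h 𝒳) :
    ∃ L : Θ → ℝ, Integrable L μ ∧ ∀ᵐ θ ∂μ,
      (∀ y ∈ 𝒳, |H κ h y θ - H κ h x θ| ≤ L θ * |y - x|) ∧
      HasDerivAt (fun y => H κ h y θ) (∫ ξ, d h x ξ ∂(κ θ)) x := by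
  obtain ⟨K, hK, hae⟩ := h₂
  have hK1 := (Measure.integrable_comp_iff (κ := κ) hK.1).1 hK
  refine ⟨fun θ => ∫ ξ, ‖K ξ‖ ∂(κ θ), hK1.2, ?_⟩
  filter_upwards [hae, hK1.1, hL2] with θ hθ hKθ hxθ
  have hix : Integrable (h x) (κ θ) := hxθ.integrable (by norm_num)
  have hlip : ∀ y ∈ 𝒳, ∀ᵐ ξ ∂(κ θ), |h y ξ - h x ξ| ≤ ‖K ξ‖ * |y - x| := by
    intro y hy
    filter_upwards [hθ.1 x hx y hy] with ξ hξ
    exact hξ.trans (mul_le_mul_of_nonneg_right (le_abs_self _) (abs_nonneg _))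
  refine ⟨fun y hy => ?_, ?_⟩
  · have hd : Integrable (fun ξ => h y ξ - h x ξ) (κ θ) := by
      refine (hKθ.norm.mul_const |y - x|).mono' ((hmeas y hy).sub (hmeas x hx)).aestronglyMeasurable
        (hlip y hy)
    have hiy : Integrable (h y) (κ θ) := by
      refine (hd.add hix).congr (Eventually.of_forall fun ω => ?_)
      simp
    unfold H
    rw [← integral_sub hiy hix, ← integral_mul_const]
    exact (abs_integral_le_integral_abs).trans
      (integral_mono_ae hd.abs (hKθ.norm.mul_const _) (hlip y hy))
  · refine hasDerivAt_integral_of_ae_lipschitz (h𝒳.mem_nhds hx)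
      (fun y hy => (hmeas y hy).aestronglyMeasurable) hix hKθ.norm hlip ?_
    filter_upwards [hθ.2 x hx] with ξ hξ
    exact hξ.hasDerivAt

theorem D_ae_eq (h𝒳 : IsOpen 𝒳) (hx : x ∈ 𝒳)
    (hmeas : ∀ y ∈ 𝒳, Measurable (h y)) (hL2 : ∀ᵐ θ ∂μ, MemLp (h x) 2 (κ θ))
    (h₂ : InterchangeAssumption μ κ h 𝒳) :
    D κ h x =ᵐ[μ] fun θ => ∫ ξ, d h x ξ ∂(κ θ) := by
  obtain ⟨L, -, hL⟩ := exists_lipschitz_hasDerivAt_H h𝒳 hx hmeas hL2 h₂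
  filter_upwards [hL] with θ hθ using hθ.2.deriv

theorem aestronglyMeasurable_D (h𝒳 : IsOpen 𝒳) (hx : x ∈ 𝒳)
    (hmeas : ∀ y ∈ 𝒳, Measurable (h y)) (hdmeas : Measurable (d h x))
    (hL2 : ∀ᵐ θ ∂μ, MemLp (h x) 2 (κ θ)) (h₂ : InterchangeAssumption μ κ h 𝒳) :
    AEStronglyMeasurable (D κ h x) μ :=
  (hdmeas.stronglyMeasurable.integral_kernel (κ := κ)).aestronglyMeasurable.congr
    (D_ae_eq h𝒳 hx hmeas hL2 h₂).symm

theorem exists_ae_abs_D_le (h𝒳 : IsOpen 𝒳) (hx : x ∈ 𝒳)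
    (hmeas : ∀ y ∈ 𝒳, Measurable (h y)) (hdmeas : Measurable (d h x))
    (hL2 : ∀ᵐ θ ∂μ, MemLp (h x) 2 (κ θ)) (h₂ : InterchangeAssumption μ κ h 𝒳)
    (h₅ : SupremumAssumption μ κ h x) : ∃ M, ∀ᵐ θ ∂μ, |D κ h x θ| ≤ M := by
  obtain ⟨C, hC⟩ := h₅
  -- From $|a|\le 1+a^2$; the maximum covers a negative $C$.
  refine ⟨1 + max C 0, ?_⟩
  filter_upwards [hC, D_ae_eq h𝒳 hx hmeas hL2 h₂] with θ hθ hD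
  rw [hD]
  have hsq : Integrable (fun ξ => d h x ξ ^ 2) (κ θ) := by
    refine ⟨(hdmeas.pow_const 2).aestronglyMeasurable, ?_⟩
    rw [hasFiniteIntegral_iff_ofReal (Eventually.of_forall fun ξ => sq_nonneg _)]
    exact hθ.trans_lt ENNReal.ofReal_lt_top
  have hle : ∫ ξ, d h x ξ ^ 2 ∂(κ θ) ≤ max C 0 := by
    rw [integral_eq_lintegral_of_nonneg_ae (Eventually.of_forall fun ξ => sq_nonneg _)
      hsq.aestronglyMeasurable]
    refine ENNReal.toReal_le_of_le_ofReal (le_max_right _ _) (hθ.trans ?_)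
    exact ENNReal.ofReal_le_ofReal (le_max_left _ _)
  calc |∫ ξ, d h x ξ ∂(κ θ)| ≤ ∫ ξ, |d h x ξ| ∂(κ θ) := abs_integral_le_integral_abs
    _ ≤ ∫ ξ, (1 + d h x ξ ^ 2) ∂(κ θ) := by
        refine integral_mono_of_nonneg (Eventually.of_forall fun _ => abs_nonneg _)
          ((integrable_const _).add hsq) (Eventually.of_forall fun ξ => ?_)
        simp only
        nlinarith [sq_abs (d h x ξ), sq_nonneg (|d h x ξ| - 1)]
    _ = 1 + ∫ ξ, d h x ξ ^ 2 ∂(κ θ) := by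
        rw [integral_add (integrable_const _) hsq]; simp
    _ ≤ 1 + max C 0 := by linarith

instance [IsProbabilityMeasure μ] (m : ℕ) : IsProbabilityMeasure (pairLaw μ κ m) := by
  unfold pairLaw; infer_instance

theorem measurable_Dhat (hdmeas : Measurable (d h x)) (m : ℕ) :
    Measurable fun ω : Θ × (Fin m → Ξ) => Dhat h x ω.2 := by
  unfold Dhat
  exact (Finset.measurable_sum _ fun j _ =>
    hdmeas.comp ((measurable_pi_apply j).comp measurable_snd)).const_mul _

theorem measurable_Hhat (hmeas : Measurable (h x)) (m : ℕ) :
    Measurable fun ω : Θ × (Fin m → Ξ) => Hhat h x ω.2 := by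
  unfold Hhat
  exact (Finset.measurable_sum _ fun j _ =>
    hmeas.comp ((measurable_pi_apply j).comp measurable_snd)).const_mul _

/-- By Cauchy–Schwarz the square of an average is at most the average of the squares, so averaging
does not increase the second moment, and the bound is uniform in $m$. -/
theorem lintegral_innerKernel_Dhat_sq_le (hdmeas : Measurable (d h x)) {m : ℕ} (hm : 1 ≤ m)
    (θ : Θ) :
    ∫⁻ ξ, ENNReal.ofReal (Dhat h x ξ ^ 2) ∂(innerKernel κ m θ) ≤
      ∫⁻ ξ, ENNReal.ofReal (d h x ξ ^ 2) ∂(κ θ) := by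
  have hm' : (0 : ℝ) < m := by exact_mod_cast hm
  have hmsq : Measurable fun ξ => ENNReal.ofReal (d h x ξ ^ 2) :=
    (hdmeas.pow_const 2).ennreal_ofReal
  have hpt : ∀ ξ : Fin m → Ξ, ENNReal.ofReal (Dhat h x ξ ^ 2) ≤
      ENNReal.ofReal (1 / m) * ∑ j, ENNReal.ofReal (d h x (ξ j) ^ 2) := by
    intro ξ
    rw [← ENNReal.ofReal_sum_of_nonneg fun _ _ => sq_nonneg _,
      ← ENNReal.ofReal_mul (by positivity)]
    refine ENNReal.ofReal_le_ofReal ?_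
    have := sq_sum_le_card_mul_sum_sq (s := Finset.univ) (f := fun j => d h x (ξ j))
    simp only [Finset.card_univ, Fintype.card_fin] at this
    unfold Dhat
    rw [mul_pow]
    calc (1 / (m : ℝ)) ^ 2 * (∑ j, d h x (ξ j)) ^ 2
        ≤ (1 / (m : ℝ)) ^ 2 * (m * ∑ j, d h x (ξ j) ^ 2) := by gcongr
      _ = 1 / m * ∑ j, d h x (ξ j) ^ 2 := by field_simp
  calc ∫⁻ ξ, ENNReal.ofReal (Dhat h x ξ ^ 2) ∂(innerKernel κ m θ)
      ≤ ∫⁻ ξ : Fin m → Ξ, ENNReal.ofReal (1 / m) * ∑ j, ENNReal.ofReal (d h x (ξ j) ^ 2)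
          ∂(innerKernel κ m θ) := lintegral_mono hpt
    _ = ENNReal.ofReal (1 / m) * ∑ j : Fin m, ∫⁻ ξ, ENNReal.ofReal (d h x ξ ^ 2) ∂(κ θ) := by
        have hj : ∀ j : Fin m, Measurable fun ξ : Fin m → Ξ => ENNReal.ofReal (d h x (ξ j) ^ 2) :=
          fun j => hmsq.comp (measurable_pi_apply j)
        rw [lintegral_const_mul _ (Finset.measurable_sum _ fun j _ => hj j),
          lintegral_finsetSum _ fun j _ => hj j]
        congr 1
        refine Finset.sum_congr rfl fun j _ => ?_
        exact (measurePreserving_eval (fun _ : Fin m => κ θ) j).lintegral_comp hmsq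
    _ = ∫⁻ ξ, ENNReal.ofReal (d h x ξ ^ 2) ∂(κ θ) := by
        rw [Finset.sum_const, Finset.card_univ, Fintype.card_fin, nsmul_eq_mul, ← mul_assoc,
          ← ENNReal.ofReal_natCast, ← ENNReal.ofReal_mul (by positivity)]
        rw [one_div_mul_cancel hm'.ne', ENNReal.ofReal_one, one_mul]

theorem exists_Dhat_sq_le [IsProbabilityMeasure μ] (hdmeas : Measurable (d h x)) (h₅ : SupremumAssumption μ κ h x) :
    ∃ C : ℝ, 0 ≤ C ∧ ∀ m : ℕ, 1 ≤ m →
      Integrable (fun ω => Dhat h x ω.2) (pairLaw μ κ m) ∧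
      Integrable (fun ω => Dhat h x ω.2 ^ 2) (pairLaw μ κ m) ∧
      ∫ ω, Dhat h x ω.2 ^ 2 ∂(pairLaw μ κ m) ≤ C := by
  obtain ⟨C, hC⟩ := h₅
  refine ⟨max C 0, le_max_right _ _, fun m hm => ?_⟩
  have hDm := measurable_Dhat (Θ := Θ) hdmeas m
  have hle : ∫⁻ ω, ENNReal.ofReal (Dhat h x ω.2 ^ 2) ∂(pairLaw μ κ m) ≤
      ENNReal.ofReal (max C 0) := by
    unfold pairLaw
    rw [Measure.lintegral_compProd (hDm.pow_const 2).ennreal_ofReal]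
    calc _ ≤ ∫⁻ _θ, ENNReal.ofReal (max C 0) ∂μ := by
          refine lintegral_mono_ae ?_
          filter_upwards [hC] with θ hθ
          exact (lintegral_innerKernel_Dhat_sq_le hdmeas hm θ).trans
            (hθ.trans (ENNReal.ofReal_le_ofReal (le_max_left _ _)))
      _ = _ := by simp
  have hsq : Integrable (fun ω => Dhat h x ω.2 ^ 2) (pairLaw μ κ m) := by
    refine ⟨(hDm.pow_const 2).aestronglyMeasurable, ?_⟩
    rw [hasFiniteIntegral_iff_ofReal (Eventually.of_forall fun ξ => sq_nonneg _)]
    exact hle.trans_lt ENNReal.ofReal_lt_top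
  refine ⟨?_, hsq, ?_⟩
  · exact ((memLp_two_iff_integrable_sq hDm.aestronglyMeasurable).2 hsq).integrable (by norm_num)
  · rw [integral_eq_lintegral_of_nonneg_ae (Eventually.of_forall fun ξ => sq_nonneg _)
      hsq.aestronglyMeasurable]
    exact ENNReal.toReal_le_of_le_ofReal (le_max_right _ _) hle

theorem measurable_normErr (hmeas : Measurable (h x)) (m : ℕ) :
    Measurable (normErr κ h x : Θ × (Fin m → Ξ) → ℝ) := by
  unfold normErr
  exact ((Finset.measurable_sum _ fun j _ =>
    (hmeas.comp ((measurable_pi_apply j).comp measurable_snd)).sub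
      ((measurable_H hmeas).comp measurable_fst)).const_mul _).const_mul _

/-- $\hat H^m=H+e/\sqrt m$ when $e$ is the normalized error. For each fixed $e$, the values of $H$
that send this into a null set form a translate of that set, so the preimage is null in the plane
and carries no mass of the joint law. Statements valid for Lebesgue-a.e. $t$ thus transfer to the
law of $\hat H^m$. -/
theorem map_Hhat_absolutelyContinuous (hmeas : Measurable (h x)) {m : ℕ} (hm : 1 ≤ m)
    {p : ℝ × ℝ → ℝ≥0∞}
    (hlaw : (pairLaw μ κ m).map (fun ω => (H κ h x ω.1, normErr κ h x ω)) =
      (volume : Measure (ℝ × ℝ)).withDensity p) :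
    (pairLaw μ κ m).map (fun ω => Hhat h x ω.2) ≪ volume := by
  refine Measure.AbsolutelyContinuous.mk fun s hs hs0 => ?_
  rw [Measure.map_apply (measurable_Hhat hmeas m) hs]
  have hadd : Measurable fun z : ℝ × ℝ => z.1 + z.2 / √(m : ℝ) := by fun_prop
  have hpm : Measurable fun ω : Θ × (Fin m → Ξ) => (H κ h x ω.1, normErr κ h x ω) :=
    ((measurable_H hmeas).comp measurable_fst).prodMk (measurable_normErr hmeas m)
  have hpre : (fun ω : Θ × (Fin m → Ξ) => Hhat h x ω.2) ⁻¹' s =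
      (fun ω : Θ × (Fin m → Ξ) => (H κ h x ω.1, normErr κ h x ω)) ⁻¹'
        ((fun z : ℝ × ℝ => z.1 + z.2 / √(m : ℝ)) ⁻¹' s) := by
    ext ω
    simp only [Set.mem_preimage]
    rw [Hhat_eq_add (κ := κ) hm ω]
  rw [hpre, ← Measure.map_apply hpm (hadd hs), hlaw]
  refine withDensity_absolutelyContinuous _ _ ?_
  rw [Measure.volume_eq_prod, Measure.prod_apply_symm (hadd hs)]
  simp only [Set.preimage_preimage]
  have : ∀ e : ℝ, (volume : Measure ℝ) ((fun u => u + e / √(m : ℝ)) ⁻¹' s) = 0 := fun e => by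
    rw [measure_preimage_add_right, hs0]
  simp [this]

/-- The distribution functions of `Ĥ^m` and of `H` differ by `O(m^{-1/2})`, uniformly. -/
theorem abs_cdf_Hhat_sub_F_le [IsProbabilityMeasure μ] (hmeas : Measurable (h x)) {m : ℕ} (hm : 1 ≤ m)
    {p : ℝ → ℝ → ℝ} {g₀ : ℝ → ℝ} (hg₀ : Measurable g₀)
    (hlaw : (pairLaw μ κ m).map (fun ω => (H κ h x ω.1, normErr κ h x ω)) =
      (volume : Measure (ℝ × ℝ)).withDensity (fun z => ENNReal.ofReal (p z.1 z.2)))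
    (hp : ∀ u e, p u e ≤ g₀ e) {C : ℝ} (hC0 : 0 ≤ C)
    (hC : ∫⁻ e, ENNReal.ofReal (|e| * g₀ e) ≤ ENNReal.ofReal C) (t : ℝ) :
    |(pairLaw μ κ m).real {ω | Hhat h x ω.2 ≤ t} - F μ κ h t x| ≤ 2 * C / √(m : ℝ) := by
  have hm' : (0 : ℝ) < m := by exact_mod_cast hm
  have hs : 0 < √(m : ℝ) := Real.sqrt_pos.2 hm'
  have hHm : Measurable fun ω : Θ × (Fin m → Ξ) => H κ h x ω.1 :=
    (measurable_H hmeas).comp measurable_fst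
  have hpm : Measurable fun ω : Θ × (Fin m → Ξ) => (H κ h x ω.1, normErr κ h x ω) :=
    hHm.prodMk (measurable_normErr hmeas m)
  have hF : F μ κ h t x = (pairLaw μ κ m).real {ω | H κ h x ω.1 ≤ t} := by
    have : μ = (pairLaw μ κ m).fst := by unfold pairLaw; rw [Measure.fst_compProd]
    unfold F
    conv_lhs => rw [this]
    have hB : MeasurableSet {θ | H κ h x θ ≤ t} := measurable_H hmeas measurableSet_Iic
    rw [measureReal_def, Measure.fst_apply hB]
    rfl
  -- The events $\hat H^m\le t$ and $H\le t$ differ only if $t$ separates $H$ from $H+e/\sqrt m$,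
  -- which forces the pair into this strip. Its slice at height $e$ has length $2|e|/\sqrt m$, so
  -- only the first absolute moment of $g_0$ enters.
  set S : Set (ℝ × ℝ) := {z | |z.1 - t| ≤ |z.2| / √(m : ℝ)} with hS
  have hSm : MeasurableSet S := measurableSet_le (by fun_prop) (by fun_prop)
  have hvol : (pairLaw μ κ m) ((fun ω => (H κ h x ω.1, normErr κ h x ω)) ⁻¹' S) ≤
      ENNReal.ofReal (2 * C / √(m : ℝ)) := by
    rw [← Measure.map_apply hpm hSm, hlaw, withDensity_apply _ hSm]
    calc ∫⁻ z in S, ENNReal.ofReal (p z.1 z.2)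
        ≤ ∫⁻ z in S, ENNReal.ofReal (g₀ z.2) :=
          lintegral_mono fun z => ENNReal.ofReal_le_ofReal (hp _ _)
      _ = ∫⁻ z, S.indicator (fun z => ENNReal.ofReal (g₀ z.2)) z :=
          (lintegral_indicator hSm _).symm
      _ = ∫⁻ e, ∫⁻ u, S.indicator (fun z => ENNReal.ofReal (g₀ z.2)) (u, e) := by
          rw [Measure.volume_eq_prod, lintegral_prod_symm']
          exact ((hg₀.comp measurable_snd).ennreal_ofReal).indicator hSm
      _ = ∫⁻ e, ENNReal.ofReal (2 / √(m : ℝ)) * ENNReal.ofReal (|e| * g₀ e) := by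
          refine lintegral_congr fun e => ?_
          have h1 : ∀ u, S.indicator (fun z => ENNReal.ofReal (g₀ z.2)) (u, e) =
              (Metric.closedBall t (|e| / √(m : ℝ))).indicator
                (fun _ => ENNReal.ofReal (g₀ e)) u := by
            intro u
            have : (u, e) ∈ S ↔ u ∈ Metric.closedBall t (|e| / √(m : ℝ)) := by
              rw [Metric.mem_closedBall, Real.dist_eq]; rfl
            by_cases hu : (u, e) ∈ S
            · rw [Set.indicator_of_mem hu, Set.indicator_of_mem (this.1 hu)]
            · rw [Set.indicator_of_notMem hu, Set.indicator_of_notMem (this.not.1 hu)]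
          simp_rw [h1]
          rw [lintegral_indicator Metric.isClosed_closedBall.measurableSet, lintegral_const,
            Measure.restrict_apply_univ, Real.volume_closedBall,
            ENNReal.ofReal_mul (abs_nonneg e),
            show 2 * (|e| / √(m : ℝ)) = 2 / √(m : ℝ) * |e| by ring,
            ENNReal.ofReal_mul (p := 2 / √(m : ℝ)) (by positivity)]
          ring
      _ = ENNReal.ofReal (2 / √(m : ℝ)) * ∫⁻ e, ENNReal.ofReal (|e| * g₀ e) := by
          rw [lintegral_const_mul _ (by fun_prop)]
      _ ≤ ENNReal.ofReal (2 / √(m : ℝ)) * ENNReal.ofReal C := by gcongr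
      _ = ENNReal.ofReal (2 * C / √(m : ℝ)) := by
          rw [← ENNReal.ofReal_mul (by positivity)]
          congr 1
          ring
  rw [hF]
  have hA : MeasurableSet {ω : Θ × (Fin m → Ξ) | Hhat h x ω.2 ≤ t} :=
    measurable_Hhat hmeas m measurableSet_Iic
  have hB : MeasurableSet {ω : Θ × (Fin m → Ξ) | H κ h x ω.1 ≤ t} := hHm measurableSet_Iic
  have hSreal : (pairLaw μ κ m).real ((fun ω => (H κ h x ω.1, normErr κ h x ω)) ⁻¹' S) ≤
      2 * C / √(m : ℝ) :=
    ENNReal.toReal_le_of_le_ofReal (by positivity) hvol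
  refine le_trans (abs_measureReal_sub_le_measureReal_symmDiff hA.nullMeasurableSet
    hB.nullMeasurableSet) (le_trans (measureReal_mono ?_) hSreal)
  rintro ω hω
  have hEq := Hhat_eq_add (h := h) (x := x) (κ := κ) hm ω
  have habs : |normErr κ h x ω / √(m : ℝ)| = |normErr κ h x ω| / √(m : ℝ) := by
    rw [abs_div, abs_of_pos hs]
  simp only [hS, Set.mem_preimage, Set.mem_ofPred_eq]
  rw [← habs]
  rcases hω with ⟨h1, h2⟩ | ⟨h1, h2⟩ <;> simp only [Set.mem_ofPred_eq, not_le] at h1 h2 <;>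
    simp only [hEq] at h1 h2 <;>
    cases abs_cases (H κ h x ω.1 - t) <;> cases abs_cases (normErr κ h x ω / √(m : ℝ)) <;>
    linarith

end Model

/-! ### Differentiability of a quantile -/

section Quantile

/-- If the measure `l` has the density `f` on a ball, its distribution function is the integral
of `f` there. -/
theorem measureReal_Iic_sub_eq_intervalIntegral {l : Measure ℝ} [IsProbabilityMeasure l]
    {f : ℝ → ℝ} {v δ : ℝ} (hf : ContinuousOn f (Metric.ball v δ))
    (hf0 : ∀ t ∈ Metric.ball v δ, 0 ≤ f t)
    (hl : l.restrict (Metric.ball v δ) =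
      (volume.restrict (Metric.ball v δ)).withDensity fun t => ENNReal.ofReal (f t))
    {s t : ℝ} (hs : s ∈ Metric.ball v δ) (ht : t ∈ Metric.ball v δ) (hst : s ≤ t) :
    l.real (Set.Iic t) - l.real (Set.Iic s) = ∫ u in s..t, f u := by
  have hsub : Set.Icc s t ⊆ Metric.ball v δ := (convex_ball v δ).ordConnected.out hs ht
  have hsub' : Set.Ioc s t ⊆ Metric.ball v δ := Set.Ioc_subset_Icc_self.trans hsub
  have hfi : IntegrableOn f (Set.Ioc s t) :=
    ((hf.mono hsub).integrableOn_Icc).mono_set Set.Ioc_subset_Icc_self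
  have h1 : l.real (Set.Iic t) - l.real (Set.Iic s) = l.real (Set.Ioc s t) := by
    rw [← measureReal_sdiff (Set.Iic_subset_Iic.2 hst) measurableSet_Iic, Set.Iic_sdiff_Iic]
  have h2 : l (Set.Ioc s t) = ∫⁻ u in Set.Ioc s t, ENNReal.ofReal (f u) := by
    have := congrArg (fun m : Measure ℝ => m (Set.Ioc s t)) hl
    simp only [Measure.restrict_apply measurableSet_Ioc, withDensity_apply _ measurableSet_Ioc,
      Measure.restrict_restrict measurableSet_Ioc, Set.inter_eq_left.2 hsub'] at this
    exact this
  rw [h1, measureReal_def, h2, intervalIntegral.integral_of_le hst,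
    integral_eq_lintegral_of_nonneg_ae _ hfi.aestronglyMeasurable]
  rw [EventuallyLE, ae_restrict_iff' measurableSet_Ioc]
  exact Eventually.of_forall fun u hu => hf0 u (hsub' hu)

theorem hasDerivAt_measureReal_Iic {l : Measure ℝ} [IsProbabilityMeasure l]
    {f : ℝ → ℝ} {v δ : ℝ} (hδ : 0 < δ) (hf : ContinuousOn f (Metric.ball v δ))
    (hf0 : ∀ t ∈ Metric.ball v δ, 0 ≤ f t)
    (hl : l.restrict (Metric.ball v δ) =
      (volume.restrict (Metric.ball v δ)).withDensity fun t => ENNReal.ofReal (f t)) :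
    HasDerivAt (fun t => l.real (Set.Iic t)) (f v) v := by
  have hv : v ∈ Metric.ball v δ := Metric.mem_ball_self hδ
  have hd : HasDerivAt (fun t => ∫ u in v..t, f u) (f v) v :=
    intervalIntegral.integral_hasDerivAt_right (by simp)
      (hf.stronglyMeasurableAtFilter Metric.isOpen_ball v hv)
      (hf.continuousAt (Metric.ball_mem_nhds v hδ))
  refine (hd.add_const (l.real (Set.Iic v))).congr_of_eventuallyEq ?_
  filter_upwards [Metric.ball_mem_nhds v hδ] with t ht
  rcases le_total v t with h | h
  · have := measureReal_Iic_sub_eq_intervalIntegral hf hf0 hl hv ht h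
    linarith
  · have := measureReal_Iic_sub_eq_intervalIntegral hf hf0 hl ht hv h
    rw [intervalIntegral.integral_symm]
    linarith

/-- Mean value inequality for $y\mapsto F(t,y)-Gy$, whose derivative is at most $\varepsilon$ in
absolute value near $(w,x)$. The uniformity in $t$ is what permits a height $t=w(y)$ moving with $y$
later on. -/
theorem exists_abs_partial_sub_le {F : ℝ → ℝ → ℝ} {w x : ℝ}
    (hd : ∀ᶠ z : ℝ × ℝ in 𝓝 (w, x), DifferentiableAt ℝ (fun y => F z.1 y) z.2)
    (hc : ContinuousAt (fun z : ℝ × ℝ => deriv (fun y => F z.1 y) z.2) (w, x))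
    {ε : ℝ} (hε : 0 < ε) :
    ∃ ρ > 0, ∀ t ∈ Metric.ball w ρ, DifferentiableAt ℝ (fun y => F t y) x ∧
      |deriv (fun y => F t y) x - deriv (fun y => F w y) x| ≤ ε ∧
      ∀ y ∈ Metric.ball x ρ,
        |F t y - F t x - deriv (fun y => F w y) x * (y - x)| ≤ ε * |y - x| := by
  set G := deriv (fun y => F w y) x with hG
  have hc' : ∀ᶠ z : ℝ × ℝ in 𝓝 (w, x), |deriv (fun y => F z.1 y) z.2 - G| < ε := by
    have := Metric.tendsto_nhds.1 hc ε hε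
    simpa [Real.dist_eq] using this
  obtain ⟨ρ, hρ, hball⟩ := Metric.eventually_nhds_iff_ball.1 (hd.and hc')
  refine ⟨ρ, hρ, fun t ht => ?_⟩
  have hmem : ∀ y ∈ Metric.ball x ρ, (t, y) ∈ Metric.ball (w, x) ρ := by
    intro y hy
    rw [← ball_prod_same]
    exact ⟨ht, hy⟩
  have hxx : x ∈ Metric.ball x ρ := Metric.mem_ball_self hρ
  refine ⟨(hball _ (hmem x hxx)).1, (hball _ (hmem x hxx)).2.le, fun y hy => ?_⟩
  have hda : ∀ y ∈ Metric.ball x ρ,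
      HasDerivWithinAt (fun y => F t y - G * y) (deriv (fun y => F t y) y - G)
        (Metric.ball x ρ) y := by
    intro y hy
    have h1 := (hball _ (hmem y hy)).1.hasDerivAt
    have h2 := (hasDerivAt_id y).const_mul G
    rw [mul_one] at h2
    exact (h1.sub h2).hasDerivWithinAt
  have := (convex_ball x ρ).norm_image_sub_le_of_norm_hasDerivWithin_le hda
    (fun y hy => (hball _ (hmem y hy)).2.le) hxx hy
  rw [Real.norm_eq_abs, Real.norm_eq_abs] at this
  convert this using 2
  ring

/-- The implicit function theorem for a quantile `w y` of the level `α` of `F · y`. -/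
theorem hasDerivAt_quantile {F : ℝ → ℝ → ℝ} {w : ℝ → ℝ} {α x f₀ : ℝ}
    (hval : ∀ᶠ y in 𝓝 x, F (w y) y = α)
    (hlow : ∀ᶠ y in 𝓝 x, ∀ t, F t y < α → t ≤ w y)
    (hup : ∀ᶠ y in 𝓝 x, ∀ t, α ≤ F t y → w y ≤ t)
    (hf : HasDerivAt (fun t => F t x) f₀ (w x)) (hf₀ : 0 < f₀)
    (hd : ∀ᶠ z : ℝ × ℝ in 𝓝 (w x, x), DifferentiableAt ℝ (fun y => F z.1 y) z.2)
    (hc : ContinuousAt (fun z : ℝ × ℝ => deriv (fun y => F z.1 y) z.2) (w x, x)) :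
    HasDerivAt w (-(deriv (fun y => F (w x) y) x) / f₀) x := by
  have hvx : F (w x) x = α := hval.self_of_nhds
  set G := deriv (fun y => F (w x) y) x with hG
  -- The positive slope puts $F(w(x)\pm r,x)$ strictly on either side of $\alpha$. Continuity in $y$
  -- at these two fixed heights keeps them there, which traps $w(y)$ between $w(x)-r$ and $w(x)+r$.
  have hcont : ContinuousAt w x := by
    have hslope := (hasDerivAt_iff_tendsto_slope.1 hf).eventually (lt_mem_nhds hf₀)
    have hdx : ∀ᶠ t in 𝓝 (w x), DifferentiableAt ℝ (fun y => F t y) x := by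
      have ht : ContinuousAt (fun t : ℝ => (t, x)) (w x) := by fun_prop
      exact ht.eventually hd
    rw [Metric.continuousAt_iff']
    intro ε hε
    have hev := hdx.and (eventually_nhdsWithin_iff.1 hslope)
    obtain ⟨ρ, hρ, hball⟩ := Metric.eventually_nhds_iff_ball.1 hev
    set r := min (ε / 2) (ρ / 2) with hr
    have hr0 : 0 < r := by positivity
    have hrε : r < ε := (min_le_left _ _).trans_lt (by linarith)
    have hrρ : r < ρ := (min_le_right _ _).trans_lt (by linarith)
    have hu := hball (w x + r) (by simp [abs_of_pos hr0, hrρ])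
    have hl := hball (w x - r) (by simp [abs_of_pos hr0, hrρ])
    have hu2 := hu.2 (by simp [hr0.ne'])
    have hl2 := hl.2 (by simp [hr0.ne'])
    rw [slope_def_field, add_sub_cancel_left, hvx] at hu2
    rw [slope_def_field, hvx, show w x - r - w x = -r by ring] at hl2
    have hu3 : α < F (w x + r) x := by
      have := (div_pos_iff_of_pos_right hr0).1 hu2
      linarith
    have hl3 : F (w x - r) x < α := by
      rw [div_neg, ← neg_div] at hl2
      have := (div_pos_iff_of_pos_right hr0).1 hl2
      linarith
    filter_upwards [hlow, hup, hu.1.continuousAt.eventually (lt_mem_nhds hu3),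
      hl.1.continuousAt.eventually (gt_mem_nhds hl3)] with y h1 h2 h3 h4
    have h5 := h1 _ h4
    have h6 := h2 _ h3.le
    rw [Real.dist_eq, abs_lt]
    constructor <;> linarith
  have hA : (fun y => F (w y) y - F (w y) x - G * (y - x)) =o[𝓝 x] fun y => y - x := by
    refine isLittleO_iff.2 fun ε hε => ?_
    obtain ⟨ρ, hρ, hb⟩ := exists_abs_partial_sub_le hd hc hε
    filter_upwards [hcont (Metric.ball_mem_nhds _ hρ), Metric.ball_mem_nhds x hρ] with y h1 h2
    exact (hb _ h1).2.2 y h2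
  have hB : (fun y => F (w y) x - F (w x) x - (w y - w x) * f₀) =o[𝓝 x] fun y => w y - w x := by
    have := (hasDerivAt_iff_isLittleO.1 hf).comp_tendsto hcont
    simpa [Function.comp_def] using this
  have hsum : ∀ᶠ y in 𝓝 x, (F (w y) x - F (w x) x - (w y - w x) * f₀) + (w y - w x) * f₀ =
      -(F (w y) y - F (w y) x - G * (y - x)) - G * (y - x) := by
    filter_upwards [hval] with y hy
    rw [hy, hvx]
    ring
  -- The remainder in `hB` is small only relative to $w(y)-w(x)$. Since it can be absorbed into
  -- $(w(y)-w(x))f_0$, `hsum` first gives $w(y)-w(x)=O(y-x)$; afterwards both remainders are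
  -- $o(y-x)$.
  have hO : (fun y => w y - w x) =O[𝓝 x] fun y => y - x := by
    have hB' : (fun y => F (w y) x - F (w x) x - (w y - w x) * f₀) =o[𝓝 x]
        fun y => (w y - w x) * f₀ :=
      hB.trans_isBigO (isBigO_of_le' (c := f₀⁻¹) _ fun y => by
        rw [norm_mul, Real.norm_of_nonneg hf₀.le]
        field_simp
        exact le_refl _)
    have h1 := hB'.right_isBigO_add
    have h2 : (fun y => -(F (w y) y - F (w y) x - G * (y - x)) - G * (y - x)) =O[𝓝 x]
        fun y => y - x :=
      hA.isBigO.neg_left.sub (isBigO_const_mul_self G _ _)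
    have h3 := (h1.trans_eventuallyEq hsum).trans h2
    refine IsBigO.trans (isBigO_of_le' (c := f₀⁻¹) _ fun y => ?_) h3
    rw [norm_mul, Real.norm_of_nonneg hf₀.le]
    field_simp
    exact le_refl _
  have hfin := ((hB.trans_isBigO hO).add hA).const_mul_left (-f₀⁻¹)
  rw [hasDerivAt_iff_isLittleO]
  refine hfin.congr' ?_ EventuallyEq.rfl
  filter_upwards [hval] with y hy
  rw [hy, hvx, smul_eq_mul]
  field_simp
  ring

end Quantile

/-! ### Value-at-Risk as a differentiable quantile -/

section ValueAtRisk

variable {Θ Ξ : Type*} [MeasurableSpace Θ] [MeasurableSpace Ξ]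
  {μ : Measure Θ} {κ : Kernel Θ Ξ} {h : ℝ → Ξ → ℝ} {α x : ℝ}

theorem F_eq_measureReal_map (hH : Measurable (H κ h x)) (t : ℝ) :
    F μ κ h t x = (μ.map (H κ h x)).real (Set.Iic t) := by
  rw [measureReal_def, Measure.map_apply hH measurableSet_Iic]
  rfl

variable [IsProbabilityMeasure μ]

theorem F_mono : Monotone fun t => F μ κ h t x := fun _ _ hst =>
  measureReal_mono fun _ hθ => le_trans hθ hst

theorem bddBelow_setOf_le_F (hα₀ : 0 < α) (hH : Measurable (H κ h x)) :
    BddBelow {t : ℝ | α ≤ F μ κ h t x} := by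
  have := Measure.isProbabilityMeasure_map hH.aemeasurable (μ := μ)
  have ht := (tendsto_cdf_atBot (μ.map (H κ h x))).eventually (gt_mem_nhds hα₀)
  obtain ⟨t, ht⟩ := ht.exists
  refine ⟨t, fun s hs => ?_⟩
  by_contra hlt
  have h1 := F_mono (μ := μ) (κ := κ) (h := h) (x := x) (not_le.1 hlt).le
  simp only at h1
  rw [cdf_eq_real, ← F_eq_measureReal_map hH] at ht
  exact absurd (lt_of_le_of_lt (le_trans hs h1) ht) (lt_irrefl _)

theorem nonempty_setOf_le_F (hα₁ : α < 1) (hH : Measurable (H κ h x)) :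
    {t : ℝ | α ≤ F μ κ h t x}.Nonempty := by
  have := Measure.isProbabilityMeasure_map hH.aemeasurable (μ := μ)
  obtain ⟨t, ht⟩ :=
    ((tendsto_cdf_atTop (μ.map (H κ h x))).eventually (lt_mem_nhds hα₁)).exists
  rw [cdf_eq_real, ← F_eq_measureReal_map hH] at ht
  exact ⟨t, ht.le⟩

theorem VaR_le (hα₀ : 0 < α) (hH : Measurable (H κ h x)) {t : ℝ} (ht : α ≤ F μ κ h t x) :
    VaR μ κ h α x ≤ t :=
  csInf_le (bddBelow_setOf_le_F hα₀ hH) ht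

theorem le_VaR (hα₁ : α < 1) (hH : Measurable (H κ h x)) {t : ℝ} (ht : F μ κ h t x < α) :
    t ≤ VaR μ κ h α x := by
  refine le_csInf (nonempty_setOf_le_F hα₁ hH) fun s hs => ?_
  by_contra hlt
  have h1 := F_mono (μ := μ) (κ := κ) (h := h) (x := x) (not_le.1 hlt).le
  exact absurd (lt_of_le_of_lt (le_trans hs h1) ht) (lt_irrefl _)

/-- By continuity, a value above $\alpha$ at the quantile would leave points to its left with
$F\ge\alpha$, and a value below $\alpha$ would leave points to its right with $F<\alpha$; each
contradicts the infimum. -/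
theorem F_VaR_eq (hα₀ : 0 < α) (hα₁ : α < 1) (hH : Measurable (H κ h x))
    (hc : ContinuousAt (fun t => F μ κ h t x) (VaR μ κ h α x)) :
    F μ κ h (VaR μ κ h α x) x = α := by
  refine le_antisymm ?_ ?_
  · by_contra hlt
    have h1 := hc.eventually (lt_mem_nhds (not_le.1 hlt))
    obtain ⟨t, ht, htv⟩ :=
      ((h1.filter_mono (nhdsWithin_le_nhds (s := Set.Iio (VaR μ κ h α x)))).and self_mem_nhdsWithin).exists
    exact absurd (VaR_le hα₀ hH ht.le) (not_le.2 htv)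
  · by_contra hlt
    have h1 := hc.eventually (gt_mem_nhds (not_le.1 hlt))
    obtain ⟨t, ht, htv⟩ :=
      ((h1.filter_mono (nhdsWithin_le_nhds (s := Set.Ioi (VaR μ κ h α x)))).and self_mem_nhdsWithin).exists
    exact absurd (le_VaR hα₁ hH ht) (not_le.2 htv)

variable {𝒳 : Set ℝ} {f : ℝ → ℝ → ℝ}

theorem hasDerivAt_F [IsSFiniteKernel κ] (hx : x ∈ 𝒳) (hmeas : ∀ y ∈ 𝒳, Measurable (h y))
    (h₃ : LocalDensityAssumption μ κ h α 𝒳 f) :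
    HasDerivAt (fun t => F μ κ h t x) (f (VaR μ κ h α x) x) (VaR μ κ h α x) := by
  obtain ⟨δ, hδ, hf, hf0, hl⟩ := (h₃ x hx).1
  have hH := measurable_H (κ := κ) (hmeas x hx)
  have := Measure.isProbabilityMeasure_map hH.aemeasurable (μ := μ)
  simp_rw [F_eq_measureReal_map hH]
  exact hasDerivAt_measureReal_Iic hδ hf hf0 hl

theorem F_VaR_eq_of_localDensity [IsSFiniteKernel κ] (hα₀ : 0 < α) (hα₁ : α < 1) (hx : x ∈ 𝒳)
    (hmeas : ∀ y ∈ 𝒳, Measurable (h y)) (h₃ : LocalDensityAssumption μ κ h α 𝒳 f) :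
    F μ κ h (VaR μ κ h α x) x = α :=
  F_VaR_eq hα₀ hα₁ (measurable_H (hmeas x hx)) (hasDerivAt_F hx hmeas h₃).continuousAt

theorem hasDerivAt_VaR [IsSFiniteKernel κ] (h𝒳 : IsOpen 𝒳) (hα₀ : 0 < α) (hα₁ : α < 1)
    (hx : x ∈ 𝒳) (hmeas : ∀ y ∈ 𝒳, Measurable (h y))
    (h₃ : LocalDensityAssumption μ κ h α 𝒳 f) (hf : 0 < f (VaR μ κ h α x) x) :
    HasDerivAt (VaR μ κ h α)
      (-(deriv (fun y => F μ κ h (VaR μ κ h α x) y) x) / f (VaR μ κ h α x) x) x := by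
  have hev : ∀ᶠ y in 𝓝 x, y ∈ 𝒳 := h𝒳.mem_nhds hx
  refine hasDerivAt_quantile (F := F μ κ h) (α := α) ?_ ?_ ?_ (hasDerivAt_F hx hmeas h₃) hf
    (h₃ x hx).2.1 (h₃ x hx).2.2
  · filter_upwards [hev] with y hy using F_VaR_eq_of_localDensity hα₀ hα₁ hy hmeas h₃
  · filter_upwards [hev] with y hy t ht using le_VaR hα₁ (measurable_H (hmeas y hy)) ht
  · filter_upwards [hev] with y hy t ht using VaR_le hα₀ (measurable_H (hmeas y hy)) ht

/-- The distribution function of `H` grows at least linearly near the quantile. -/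
theorem exists_linear_growth_F [IsSFiniteKernel κ] (hα₀ : 0 < α) (hα₁ : α < 1)
    (hx : x ∈ 𝒳) (hmeas : ∀ y ∈ 𝒳, Measurable (h y))
    (h₃ : LocalDensityAssumption μ κ h α 𝒳 f) (hf : 0 < f (VaR μ κ h α x) x) :
    ∃ c > 0, ∃ ρ > 0, ∀ s, 0 ≤ s → s < ρ →
      α + c * s ≤ F μ κ h (VaR μ κ h α x + s) x ∧
      F μ κ h (VaR μ κ h α x - s) x ≤ α - c * s := by
  have hd := hasDerivAt_F hx hmeas h₃
  have hv := F_VaR_eq_of_localDensity hα₀ hα₁ hx hmeas h₃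
  set v := VaR μ κ h α x
  have hslope := (hasDerivAt_iff_tendsto_slope.1 hd).eventually (lt_mem_nhds (half_lt_self hf))
  obtain ⟨ρ, hρ, hball⟩ := Metric.eventually_nhds_iff_ball.1 (eventually_nhdsWithin_iff.1 hslope)
  -- The difference quotients at the quantile tend to the density there, so half of it is a valid
  -- slope on a small ball.
  refine ⟨f v x / 2, by positivity, ρ, hρ, fun s hs hsρ => ?_⟩
  rcases hs.eq_or_lt with rfl | hs
  · simp [hv]
  have h1 := hball (v + s) (by simp [abs_of_pos hs, hsρ]) (by simp [hs.ne'])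
  have h2 := hball (v - s) (by simp [abs_of_pos hs, hsρ]) (by simp [hs.ne'])
  rw [slope_def_field, add_sub_cancel_left, hv, lt_div_iff₀ hs] at h1
  rw [slope_def_field, hv, show v - s - v = -s by ring, div_neg, ← neg_div, lt_div_iff₀ hs] at h2
  constructor <;> linarith

end ValueAtRisk

/-! ### Regression functions -/

section Regression

/-- `γ` is a version of the regression function `t ↦ E[Y | X = t]`. -/
structure IsRegression {Ω : Type*} [MeasurableSpace Ω] (P : Measure Ω) (Y X : Ω → ℝ)
    (γ : ℝ → ℝ) : Prop where
  measurable : Measurable γ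
  integrable : Integrable (fun ω => γ (X ω)) P
  integral_eq_zero : ∀ c : ℝ → ℝ, Measurable c → (∃ M, ∀ t, |c t| ≤ M) →
    ∫ ω, c (X ω) * (Y ω - γ (X ω)) ∂P = 0

section CondLaw

variable {Ω : Type*} [MeasurableSpace Ω] {P : Measure Ω} {X Y : Ω → ℝ}
  {ν : Kernel ℝ ℝ}

theorem integrable_snd_of_isCondLaw (hX : Measurable X) (hY : Integrable Y P)
    (hν : IsCondLaw P Y X ν) : Integrable (fun z : ℝ × ℝ => z.2) (P.map X ⊗ₘ ν) := by
  rw [← hν.2, integrable_map_measure measurable_snd.aestronglyMeasurable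
    (hX.aemeasurable.prodMk hY.1.aemeasurable)]
  exact hY

variable [IsProbabilityMeasure P]

theorem ae_integrable_of_isCondLaw (hX : Measurable X) (hY : Integrable Y P)
    (hν : IsCondLaw P Y X ν) : ∀ᵐ t ∂(P.map X), Integrable (fun y => y) (ν t) := by
  have := hν.1
  exact ((Measure.integrable_compProd_iff measurable_snd.aestronglyMeasurable).1
    (integrable_snd_of_isCondLaw hX hY hν)).1

/-- Disintegrate $\mathbb E[c(X)Y]$ along the conditional law. Where $\nu(\cdot;t)$ has no mean the
integral defaults to $0$, which happens only on a null set of the law of $X$. -/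
theorem isRegression_of_isCondLaw (hX : Measurable X) (hY : Integrable Y P)
    (hν : IsCondLaw P Y X ν) : IsRegression P Y X fun t => ∫ y, y ∂(ν t) := by
  have hM := hν.1
  have hP := Measure.isProbabilityMeasure_map hX.aemeasurable (μ := P)
  have hsnd := integrable_snd_of_isCondLaw hX hY hν
  have hγm : Measurable fun t => ∫ y, y ∂(ν t) :=
    (StronglyMeasurable.integral_kernel (κ := ν) stronglyMeasurable_id).measurable
  have hγi : Integrable (fun t => ∫ y, y ∂(ν t)) (P.map X) :=
    ((Measure.integrable_compProd_iff measurable_snd.aestronglyMeasurable).1 hsnd).2.mono'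
      hγm.aestronglyMeasurable (Eventually.of_forall fun t => norm_integral_le_integral_norm _)
  have hγX : Integrable (fun ω => ∫ y, y ∂(ν (X ω))) P := hγi.comp_measurable hX
  refine ⟨hγm, hγX, fun c hc hcb => ?_⟩
  obtain ⟨M, hM⟩ := hcb
  have hcX : AEStronglyMeasurable (fun ω => c (X ω)) P := (hc.comp hX).aestronglyMeasurable
  have h1 : Integrable (fun ω => c (X ω) * Y ω) P :=
    hY.bdd_mul hcX (Eventually.of_forall fun ω => hM _)
  have h2 : Integrable (fun ω => c (X ω) * ∫ y, y ∂(ν (X ω))) P :=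
    hγX.bdd_mul hcX (Eventually.of_forall fun ω => hM _)
  have h3 : ∫ ω, c (X ω) * Y ω ∂P = ∫ ω, c (X ω) * ∫ y, y ∂(ν (X ω)) ∂P := by
    have hcm : Measurable fun z : ℝ × ℝ => c z.1 * z.2 :=
      (hc.comp measurable_fst).mul measurable_snd
    have hci : Integrable (fun z : ℝ × ℝ => c z.1 * z.2) (P.map X ⊗ₘ ν) :=
      hsnd.bdd_mul (hc.comp measurable_fst).aestronglyMeasurable
        (Eventually.of_forall fun z => hM _)
    calc ∫ ω, c (X ω) * Y ω ∂P
        = ∫ z, c z.1 * z.2 ∂(P.map fun ω => (X ω, Y ω)) :=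
          (integral_map (hX.aemeasurable.prodMk hY.1.aemeasurable) hcm.aestronglyMeasurable).symm
      _ = ∫ t, ∫ y, c t * y ∂(ν t) ∂(P.map X) := by
          rw [hν.2, Measure.integral_compProd hci]
      _ = ∫ t, c t * ∫ y, y ∂(ν t) ∂(P.map X) := 
          integral_congr_ae (Eventually.of_forall fun t => integral_const_mul (c t) _)
      _ = _ := integral_map hX.aemeasurable (hc.mul hγm).aestronglyMeasurable
  simp_rw [mul_sub]
  rw [integral_sub h1 h2, h3, sub_self]

end CondLaw

variable {Θ Ξ : Type*} [MeasurableSpace Θ] [MeasurableSpace Ξ]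
  {μ : Measure Θ} [IsProbabilityMeasure μ] {κ : Kernel Θ Ξ} {h : ℝ → Ξ → ℝ} {α x : ℝ}

/-- The pull-out property of conditional expectation. It brings an arbitrary version $g$ and the
means of the conditional laws under one notion of regression function. -/
theorem isRegression_of_isCondMean {g : ℝ → ℝ} (hH : Measurable (H κ h x))
    (hD : Integrable (D κ h x) μ) (hg : IsCondMean μ κ h x g) :
    IsRegression μ (D κ h x) (H κ h x) g := by
  have hgi : Integrable (fun θ => g (H κ h x θ)) μ := integrable_condExp.congr hg.2.symm
  refine ⟨hg.1, hgi, fun c hc hcb => ?_⟩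
  obtain ⟨M, hM⟩ := hcb
  have hcX : AEStronglyMeasurable (fun θ => c (H κ h x θ)) μ := (hc.comp hH).aestronglyMeasurable
  have h1 : Integrable (fun θ => c (H κ h x θ) * D κ h x θ) μ :=
    hD.bdd_mul hcX (Eventually.of_forall fun ω => hM _)
  have h2 : Integrable (fun θ => c (H κ h x θ) * g (H κ h x θ)) μ :=
    hgi.bdd_mul hcX (Eventually.of_forall fun ω => hM _)
  have hpull := condExp_mul_of_stronglyMeasurable_left (μ := μ)
    (m := MeasurableSpace.comap (H κ h x) inferInstance)
    (f := fun θ => c (H κ h x θ)) (g := D κ h x)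
    (hc.comp (comap_measurable (H κ h x))).stronglyMeasurable h1 hD
  have h3 : ∫ θ, c (H κ h x θ) * D κ h x θ ∂μ = ∫ θ, c (H κ h x θ) * g (H κ h x θ) ∂μ := by
    have hint := integral_condExp (μ := μ) (f := (fun θ => c (H κ h x θ)) * D κ h x)
      hH.comap_le
    refine hint.symm.trans (integral_congr_ae ?_)
    filter_upwards [hpull, hg.2] with θ h4 h5
    rw [h4, Pi.mul_apply, h5]
  simp_rw [mul_sub]
  rw [integral_sub h1 h2, h3, sub_self]

end Regression

/-! ### The regression function of the gradient near the quantile -/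

section Identification

variable {Θ Ξ : Type*} [MeasurableSpace Θ] [MeasurableSpace Ξ]
  {μ : Measure Θ} [IsProbabilityMeasure μ] {κ : Kernel Θ Ξ}
  {h : ℝ → Ξ → ℝ} {α x : ℝ} {𝒳 : Set ℝ} {f : ℝ → ℝ → ℝ}

/-- Fubini applied to $\chi(t)\mathbf 1_{\{t<X\}}$. It expresses the mean of an antiderivative of
$\chi$ at $X$ through the distribution function of $X$, which makes $\partial_yF$ accessible. -/
theorem integral_integral_Iio_eq {Ω : Type*} [MeasurableSpace Ω] {P : Measure Ω}
    [IsProbabilityMeasure P] {X : Ω → ℝ} (hX : Measurable X) {χ : ℝ → ℝ} (hχ : Integrable χ) :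
    ∫ ω, (∫ t in Set.Iio (X ω), χ t) ∂P = ∫ t, χ t * (1 - P.real {ω | X ω ≤ t}) := by
  have hS : MeasurableSet {z : Ω × ℝ | z.2 < X z.1} :=
    measurableSet_lt measurable_snd (hX.comp measurable_fst)
  have hint : Integrable (Function.uncurry fun ω t => (Set.Iio (X ω)).indicator χ t)
      (P.prod volume) := by
    have : (Function.uncurry fun ω t => (Set.Iio (X ω)).indicator χ t) =
        {z : Ω × ℝ | z.2 < X z.1}.indicator fun z => χ z.2 := by
      ext ⟨ω, t⟩
      rfl
    rw [this]
    exact (hχ.comp_snd P).indicator hS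
  calc ∫ ω, (∫ t in Set.Iio (X ω), χ t) ∂P = ∫ ω, (∫ t, (Set.Iio (X ω)).indicator χ t) ∂P := by
        simp_rw [integral_indicator measurableSet_Iio]
    _ = ∫ t, ∫ ω, (Set.Iio (X ω)).indicator χ t ∂P := integral_integral_swap hint
    _ = ∫ t, χ t * (1 - P.real {ω | X ω ≤ t}) := by
        refine integral_congr_ae (Eventually.of_forall fun t => ?_)
        have hm : MeasurableSet {ω | X ω ≤ t} := hX measurableSet_Iic
        have h1 : (fun ω => (Set.Iio (X ω)).indicator χ t) =
            {ω | X ω ≤ t}ᶜ.indicator fun _ => χ t := by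
          ext ω
          by_cases hω : X ω ≤ t
          · rw [Set.indicator_of_notMem (by simpa using hω),
              Set.indicator_of_notMem (by simpa using hω)]
          · rw [Set.indicator_of_mem (by simpa using hω),
              Set.indicator_of_mem (by simpa using hω)]
        simp only
        rw [h1, integral_indicator_const _ hm.compl, probReal_compl_eq_one_sub hm, smul_eq_mul,
          mul_comm]

theorem integral_Iio_sub_eq {χ : ℝ → ℝ} (hχ : Integrable χ) (a b : ℝ) :
    ∫ t in Set.Iio b, χ t = (∫ t in Set.Iio a, χ t) + ∫ t in a..b, χ t := by
  rw [← integral_Iic_eq_integral_Iio, ← integral_Iic_eq_integral_Iio,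
    ← intervalIntegral.integral_Iic_sub_Iic hχ.integrableOn hχ.integrableOn]
  ring

/-- The point is measurability in $t$: the derivative is a limit of difference quotients along a
fixed sequence, and these are measurable because $F$ is monotone in $t$. -/
theorem integrableOn_deriv_F {v ρ C : ℝ}
    (hF : ∀ t ∈ Metric.ball v ρ, DifferentiableAt ℝ (fun y => F μ κ h t y) x ∧
      |deriv (fun y => F μ κ h t y) x| ≤ C) :
    IntegrableOn (fun t => deriv (fun y => F μ κ h t y) x) (Metric.ball v ρ) := by
  have hae : ∀ᵐ t ∂(volume.restrict (Metric.ball v ρ)), t ∈ Metric.ball v ρ :=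
    ae_restrict_mem Metric.isOpen_ball.measurableSet
  have hm : AEStronglyMeasurable (fun t => deriv (fun y => F μ κ h t y) x)
      (volume.restrict (Metric.ball v ρ)) := by
    have hseq : Tendsto (fun k : ℕ => x + 1 / ((k : ℝ) + 1)) atTop (𝓝[≠] x) := by
      refine tendsto_nhdsWithin_iff.2 ⟨?_, Eventually.of_forall fun k => ?_⟩
      · simpa using tendsto_one_div_add_atTop_nhds_zero_nat.const_add x
      · have : (0 : ℝ) < 1 / ((k : ℝ) + 1) := by positivity
        simp only [Set.mem_compl_iff, Set.mem_singleton_iff]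
        linarith
    refine aestronglyMeasurable_of_tendsto_ae atTop
      (f := fun (k : ℕ) t => slope (fun y => F μ κ h t y) x (x + 1 / ((k : ℝ) + 1))) ?_ ?_
    · intro k
      simp only [slope_def_field]
      have hmF : ∀ y, Measurable fun t => F μ κ h t y := fun y => F_mono.measurable
      exact (((hmF _).sub (hmF _)).div_const _).aestronglyMeasurable
    · filter_upwards [hae] with t ht
      exact (hF t ht).1.hasDerivAt.tendsto_slope.comp hseq
  refine Integrable.mono' (g := fun _ => C) (integrableOn_const measure_ball_lt_top.ne) hm ?_
  filter_upwards [hae] with t ht using (hF t ht).2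

variable [IsMarkovKernel κ]

/-- With $\psi$ an antiderivative of $\chi$, differentiate $\mathbb
E\,\psi(H(y;\theta))=\int\chi(t)(1-F(t;y))\,dt$ at $y=x$ on both sides. The left side uses the chain
rule and the integrable Lipschitz constant of $H$; the right side uses the uniform bound on
increments of $F$ over the support of $\chi$. Uniqueness of the derivative gives the identity. -/
theorem integral_comp_H_mul_D_eq (h𝒳 : IsOpen 𝒳) (hx : x ∈ 𝒳)
    (hmeas : ∀ y ∈ 𝒳, Measurable (h y)) (hL2 : ∀ᵐ θ ∂μ, MemLp (h x) 2 (κ θ))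
    (h₂ : InterchangeAssumption μ κ h 𝒳) {v ρ C : ℝ} (hρ : 0 < ρ)
    (hF : ∀ t ∈ Metric.ball v ρ, DifferentiableAt ℝ (fun y => F μ κ h t y) x ∧
      ∀ y ∈ Metric.ball x ρ, |F μ κ h t y - F μ κ h t x| ≤ C * |y - x|)
    {χ : ℝ → ℝ} (hχ : Continuous χ) (hχc : HasCompactSupport χ)
    (hχs : tsupport χ ⊆ Metric.ball v ρ) :
    ∫ θ, χ (H κ h x θ) * D κ h x θ ∂μ =
      -∫ t, χ t * deriv (fun y => F μ κ h t y) x := by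
  have hχi : Integrable χ := hχ.integrable_of_hasCompactSupport hχc
  obtain ⟨M, hM⟩ := hχ.bounded_above_of_compact_support hχc
  set ψ : ℝ → ℝ := fun s => ∫ t in Set.Iio s, χ t with hψ
  have hψsub : ∀ a b, ψ b - ψ a = ∫ t in a..b, χ t := fun a b => by
    simp only [hψ]
    rw [integral_Iio_sub_eq hχi a b]
    ring
  have hψd : ∀ s, HasDerivAt ψ (χ s) s := by
    intro s
    have h1 : HasDerivAt (fun b => ∫ t in s..b, χ t) (χ s) s :=
      intervalIntegral.integral_hasDerivAt_right (by simp)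
        hχ.stronglyMeasurable.stronglyMeasurableAtFilter hχ.continuousAt
    refine (h1.const_add (ψ s)).congr_of_eventuallyEq (Eventually.of_forall fun b => ?_)
    have := hψsub s b
    simp only
    linarith
  have hψc : Continuous ψ := continuous_iff_continuousAt.2 fun s => (hψd s).continuousAt
  have hψlip : ∀ a b, |ψ b - ψ a| ≤ M * |b - a| := by
    intro a b
    rw [hψsub]
    exact intervalIntegral.norm_integral_le_of_norm_le_const fun t _ => hM t
  have hψb : ∀ s, ‖ψ s‖ ≤ ∫ t, ‖χ t‖ := fun s =>
    (norm_integral_le_integral_norm _).trans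
      (setIntegral_le_integral hχi.norm (Eventually.of_forall fun _ => norm_nonneg _))
  have hM0 : 0 ≤ M := (norm_nonneg _).trans (hM 0)
  obtain ⟨L, hL, hLae⟩ := exists_lipschitz_hasDerivAt_H h𝒳 hx hmeas hL2 h₂
  have hWd : HasDerivAt (fun y => ∫ θ, ψ (H κ h y θ) ∂μ)
      (∫ θ, χ (H κ h x θ) * D κ h x θ ∂μ) x := by
    have hmH : ∀ y ∈ 𝒳, AEStronglyMeasurable (fun θ => ψ (H κ h y θ)) μ := fun y hy =>
      (hψc.measurable.comp (measurable_H (hmeas y hy))).aestronglyMeasurable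
    refine hasDerivAt_integral_of_ae_lipschitz (K := fun θ => M * L θ) (h𝒳.mem_nhds hx) hmH ?_
      (hL.const_mul M) ?_ ?_
    · exact (integrable_const (∫ t, ‖χ t‖)).mono' (hmH x hx)
        (Eventually.of_forall fun θ => hψb _)
    · intro y hy
      filter_upwards [hLae] with θ hθ
      calc |ψ (H κ h y θ) - ψ (H κ h x θ)| ≤ M * |H κ h y θ - H κ h x θ| := hψlip _ _
        _ ≤ M * (L θ * |y - x|) := mul_le_mul_of_nonneg_left (hθ.1 y hy) hM0
        _ = M * L θ * |y - x| := by ring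
    · filter_upwards [hLae] with θ hθ
      have h1 : HasDerivAt (fun y => H κ h y θ) (D κ h x θ) x :=
        hθ.2.differentiableAt.hasDerivAt
      exact (hψd (H κ h x θ)).comp x h1
  have hW : ∀ y ∈ 𝒳, ∫ θ, ψ (H κ h y θ) ∂μ = ∫ t, χ t * (1 - F μ κ h t y) := fun y hy =>
    integral_integral_Iio_eq (measurable_H (hmeas y hy)) hχi
  have hRd : HasDerivAt (fun y => ∫ t, χ t * (1 - F μ κ h t y))
      (∫ t, χ t * -deriv (fun y => F μ κ h t y) x) x := by
    have hmF : ∀ y, Measurable fun t => F μ κ h t y := fun y => F_mono.measurable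
    have hm : ∀ y, AEStronglyMeasurable (fun t => χ t * (1 - F μ κ h t y)) volume := fun y =>
      (hχ.measurable.mul (measurable_const.sub (hmF y))).aestronglyMeasurable
    refine hasDerivAt_integral_of_ae_lipschitz (K := fun t => C * |χ t|)
      (Metric.ball_mem_nhds x hρ) (fun y _ => hm y) ?_ (hχi.abs.const_mul C) ?_ ?_
    · refine hχi.norm.mono' (hm x) (Eventually.of_forall fun t => ?_)
      rw [norm_mul]
      refine mul_le_of_le_one_right (norm_nonneg _) ?_
      have h0 : 0 ≤ F μ κ h t x := measureReal_nonneg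
      have h1 : F μ κ h t x ≤ 1 := measureReal_le_one
      rw [Real.norm_eq_abs, abs_le]
      constructor <;> linarith
    · intro y hy
      refine Eventually.of_forall fun t => ?_
      by_cases ht : t ∈ Metric.ball v ρ
      · have := (hF t ht).2 y hy
        rw [show χ t * (1 - F μ κ h t y) - χ t * (1 - F μ κ h t x) =
          -(χ t * (F μ κ h t y - F μ κ h t x)) by ring, abs_neg, abs_mul]
        calc |χ t| * |F μ κ h t y - F μ κ h t x| ≤ |χ t| * (C * |y - x|) := by gcongr
          _ = C * |χ t| * |y - x| := by ring
      · simp [image_eq_zero_of_notMem_tsupport fun hm => ht (hχs hm)]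
    · refine Eventually.of_forall fun t => ?_
      by_cases ht : t ∈ Metric.ball v ρ
      · exact ((hF t ht).1.hasDerivAt.const_sub 1).const_mul (χ t)
      · simp only [image_eq_zero_of_notMem_tsupport fun hm => ht (hχs hm), zero_mul]
        exact hasDerivAt_const _ _
  have hRd' := hRd.congr_of_eventuallyEq (f₁ := fun y => ∫ θ, ψ (H κ h y θ) ∂μ) (by
    filter_upwards [h𝒳.mem_nhds hx] with y hy using hW y hy)
  rw [hWd.unique hRd', ← integral_neg]
  simp_rw [mul_neg]

/-- Every regression function of the gradient on the objective agrees almost everywhere, near the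
quantile, with `-∂ₓF / f`. -/
theorem ae_mul_density_eq_of_isRegression (h𝒳 : IsOpen 𝒳) (hx : x ∈ 𝒳)
    (hmeas : ∀ y ∈ 𝒳, Measurable (h y)) (hL2 : ∀ᵐ θ ∂μ, MemLp (h x) 2 (κ θ))
    (h₂ : InterchangeAssumption μ κ h 𝒳) (hD : Integrable (D κ h x) μ)
    (h₃ : LocalDensityAssumption μ κ h α 𝒳 f) {γ : ℝ → ℝ}
    (hγ : IsRegression μ (D κ h x) (H κ h x) γ) :
    ∃ ρ > 0, ∀ᵐ t, t ∈ Metric.ball (VaR μ κ h α x) ρ →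
      γ t * f t x = -deriv (fun y => F μ κ h t y) x := by
  obtain ⟨⟨δ, hδ, hfc, hf0, hl⟩, hdiff, hcont⟩ := h₃ x hx
  set v := VaR μ κ h α x with hv
  have hH := measurable_H (κ := κ) (hmeas x hx)
  obtain ⟨ρ₀, hρ₀, hFρ⟩ := exists_abs_partial_sub_le hdiff hcont one_pos
  set Fx := fun t => deriv (fun y => F μ κ h t y) x with hFx
  set ρ := min ρ₀ δ with hρdef
  have hρ : 0 < ρ := lt_min hρ₀ hδ
  have hsub : Metric.ball v ρ ⊆ Metric.ball v δ := Metric.ball_subset_ball (min_le_right _ _)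
  have hsub₀ : Metric.ball v ρ ⊆ Metric.ball v ρ₀ := Metric.ball_subset_ball (min_le_left _ _)
  have hsub₀' : Metric.ball x ρ ⊆ Metric.ball x ρ₀ := Metric.ball_subset_ball (min_le_left _ _)
  have hF1 : ∀ t ∈ Metric.ball v ρ, DifferentiableAt ℝ (fun y => F μ κ h t y) x ∧
      ∀ y ∈ Metric.ball x ρ, |F μ κ h t y - F μ κ h t x| ≤ (1 + |Fx v|) * |y - x| := by
    intro t ht
    refine ⟨(hFρ t (hsub₀ ht)).1, fun y hy => ?_⟩
    have h1 := (hFρ t (hsub₀ ht)).2.2 y (hsub₀' hy)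
    have h2 := abs_add_le (F μ κ h t y - F μ κ h t x - Fx v * (y - x)) (Fx v * (y - x))
    rw [sub_add_cancel, abs_mul] at h2
    linarith
  have hF2 : ∀ t ∈ Metric.ball v ρ, DifferentiableAt ℝ (fun y => F μ κ h t y) x ∧
      |Fx t| ≤ 1 + |Fx v| := by
    intro t ht
    refine ⟨(hFρ t (hsub₀ ht)).1, ?_⟩
    have h1 := (hFρ t (hsub₀ ht)).2.1
    have h2 := abs_add_le (Fx t - Fx v) (Fx v)
    rw [sub_add_cancel] at h2
    exact h2.trans (add_le_add_left h1 _)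
  have hfm : AEMeasurable (fun t => ENNReal.ofReal (f t x))
      (volume.restrict (Metric.ball v δ)) :=
    (hfc.aemeasurable Metric.isOpen_ball.measurableSet).ennreal_ofReal
  have hflt : ∀ᵐ t ∂(volume.restrict (Metric.ball v δ)), ENNReal.ofReal (f t x) < ⊤ :=
    Eventually.of_forall fun t => ENNReal.ofReal_lt_top
  have hftr : ∀ᵐ t ∂(volume.restrict (Metric.ball v δ)),
      (ENNReal.ofReal (f t x)).toReal = f t x := by
    filter_upwards [ae_restrict_mem Metric.isOpen_ball.measurableSet] with t ht
    exact ENNReal.toReal_ofReal (hf0 t ht)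
  have hγi : Integrable γ (μ.map (H κ h x)) :=
    (integrable_map_measure hγ.measurable.aestronglyMeasurable hH.aemeasurable).2 hγ.integrable
  have hγf : IntegrableOn (fun t => γ t * f t x) (Metric.ball v δ) := by
    have h1 := hγi.integrableOn (s := Metric.ball v δ)
    rw [IntegrableOn, hl, integrable_withDensity_iff_integrable_smul₀' hfm hflt] at h1
    refine h1.congr ?_
    filter_upwards [hftr] with t ht
    rw [ht, smul_eq_mul, mul_comm]
  refine ⟨ρ, hρ, ?_⟩
  -- The fundamental lemma of the calculus of variations: $\gamma f+\partial_xF$ integrates to zero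
  -- against every smooth test function supported in the ball.
  have key : ∀ᵐ t, t ∈ Metric.ball v ρ → γ t * f t x + Fx t = 0 := by
    refine Metric.isOpen_ball.ae_eq_zero_of_integral_contDiff_smul_eq_zero
      ((hγf.mono_set hsub).add (integrableOn_deriv_F hF2)).locallyIntegrableOn ?_
    intro χ hχd hχc hχs
    have hχ := hχd.continuous
    obtain ⟨M, hM⟩ := hχ.bounded_above_of_compact_support hχc
    have hzero : ∀ t, t ∉ Metric.ball v ρ → χ t = 0 := fun t ht =>
      image_eq_zero_of_notMem_tsupport fun hm => ht (hχs hm)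
    have h1 := integral_comp_H_mul_D_eq h𝒳 hx hmeas hL2 h₂ hρ hF1 hχ hχc hχs
    have h2 := hγ.integral_eq_zero χ hχ.measurable ⟨M, hM⟩
    have hcX : AEStronglyMeasurable (fun θ => χ (H κ h x θ)) μ :=
      (hχ.measurable.comp hH).aestronglyMeasurable
    simp_rw [mul_sub] at h2
    rw [integral_sub (hD.bdd_mul hcX (Eventually.of_forall fun ω => hM _))
      (hγ.integrable.bdd_mul hcX (Eventually.of_forall fun ω => hM _)), sub_eq_zero, h1] at h2
    -- The law of $H$ has a known density only near the quantile; this suffices because $\chi$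
    -- vanishes outside the ball.
    have h3 : ∫ θ, χ (H κ h x θ) * γ (H κ h x θ) ∂μ = ∫ t, χ t * (γ t * f t x) := by
      calc ∫ θ, χ (H κ h x θ) * γ (H κ h x θ) ∂μ
          = ∫ t, χ t * γ t ∂(μ.map (H κ h x)) :=
            (integral_map hH.aemeasurable
              (hχ.measurable.mul hγ.measurable).aestronglyMeasurable).symm
        _ = ∫ t in Metric.ball v δ, χ t * γ t ∂(μ.map (H κ h x)) := by
            refine (setIntegral_eq_integral_of_forall_compl_eq_zero fun t ht => ?_).symm
            rw [hzero t fun hm => ht (hsub hm), zero_mul]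
        _ = ∫ t in Metric.ball v δ, χ t * (γ t * f t x) := by
            rw [hl, integral_withDensity_eq_integral_toReal_smul₀ hfm hflt]
            refine integral_congr_ae ?_
            filter_upwards [hftr] with t ht
            rw [ht, smul_eq_mul]
            ring
        _ = ∫ t, χ t * (γ t * f t x) := by
            refine setIntegral_eq_integral_of_forall_compl_eq_zero fun t ht => ?_
            rw [hzero t fun hm => ht (hsub hm), zero_mul]
    rw [h3] at h2
    have hout : ∀ u : ℝ → ℝ, IntegrableOn u (Metric.ball v ρ) →
        Integrable fun t => χ t * u t := by
      intro u hu
      have h4 : IntegrableOn (fun t => χ t * u t) (Metric.ball v ρ) :=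
        Integrable.bdd_mul hu hχ.aestronglyMeasurable (Eventually.of_forall hM)
      refine (integrableOn_iff_integrable_of_support_subset fun t ht => ?_).1 h4
      by_contra hmem
      exact ht (by simp [hzero t hmem])
    simp_rw [smul_eq_mul, mul_add]
    rw [integral_add (hout _ (hγf.mono_set hsub)) (hout _ (integrableOn_deriv_F hF2)), ← h2]
    simp
  filter_upwards [key] with t ht htb
  exact eq_neg_of_add_eq_zero_left (ht htb)

end Identification

/-! ### The bias of a concomitant of an order statistic -/

section Bias

/-- Two laws that differ on every set by at most `G` have means that differ by at most the first
absolute moment of `G`. -/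
theorem abs_integral_sub_integral_le {ν₁ ν₂ G : Measure ℝ} [IsFiniteMeasure ν₁]
    [IsFiniteMeasure ν₂]
    (hG : ∀ B, MeasurableSet B → ENNReal.ofReal |ν₁.real B - ν₂.real B| ≤ G B)
    (hfin : absMoment G ≠ ⊤) (hi : Integrable (fun y => y) ν₁) :
    |∫ y, y ∂ν₁ - ∫ y, y ∂ν₂| ≤ (absMoment G).toReal := by
  -- The setwise bound is an inequality of measures $\nu_1\le\nu_2+G$, and symmetrically, so it
  -- integrates against any nonnegative function. In particular integrability passes from $\nu_1$ to
  -- $\nu_2$.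
  have hle : ∀ (m₁ m₂ : Measure ℝ) [IsFiniteMeasure m₁] [IsFiniteMeasure m₂],
      (∀ B, MeasurableSet B → ENNReal.ofReal |m₁.real B - m₂.real B| ≤ G B) → m₁ ≤ m₂ + G := by
    intro m₁ m₂ _ _ hm
    refine Measure.le_iff.2 fun B hB => ?_
    rw [Measure.add_apply]
    calc m₁ B = ENNReal.ofReal (m₁.real B) := (ofReal_measureReal).symm
      _ ≤ ENNReal.ofReal (m₂.real B + |m₁.real B - m₂.real B|) :=
          ENNReal.ofReal_le_ofReal (by linarith [le_abs_self (m₁.real B - m₂.real B)])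
      _ = m₂ B + ENNReal.ofReal |m₁.real B - m₂.real B| := by
          rw [ENNReal.ofReal_add measureReal_nonneg (abs_nonneg _), ofReal_measureReal]
      _ ≤ m₂ B + G B := by gcongr; exact hm B hB
  have h12 := hle ν₁ ν₂ hG
  have h21 := hle ν₂ ν₁ fun B hB => by rw [abs_sub_comm]; exact hG B hB
  have hlin : ∀ {m₁ m₂ : Measure ℝ} (u : ℝ → ℝ≥0∞), m₁ ≤ m₂ + G →
      ∫⁻ y, u y ∂m₁ ≤ ∫⁻ y, u y ∂m₂ + ∫⁻ y, u y ∂G := by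
    intro m₁ m₂ u hm
    rw [← lintegral_add_measure]
    exact lintegral_mono' hm le_rfl
  have hi₂ : Integrable (fun y => y) ν₂ := by
    refine ⟨measurable_id.aestronglyMeasurable, ?_⟩
    have h1 := hi.2
    rw [hasFiniteIntegral_iff_norm] at h1 ⊢
    refine (hlin _ h21).trans_lt (ENNReal.add_lt_top.2 ⟨h1, lt_top_iff_ne_top.2 hfin⟩)
  -- Positive and negative parts are compared separately. Their errors add up to $\int|y|\,dG$
  -- exactly, so no factor $2$ is lost.
  rw [integral_eq_lintegral_pos_part_sub_lintegral_neg_part hi,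
    integral_eq_lintegral_pos_part_sub_lintegral_neg_part hi₂]
  have hsplit : absMoment G =
      ∫⁻ y, ENNReal.ofReal y ∂G + ∫⁻ y, ENNReal.ofReal (-y) ∂G := by
    unfold absMoment
    rw [← lintegral_add_left (by fun_prop)]
    refine lintegral_congr fun y => ?_
    rcases le_total 0 y with hy | hy
    · rw [abs_of_nonneg hy, ENNReal.ofReal_of_nonpos (neg_nonpos.2 hy), add_zero]
    · rw [abs_of_nonpos hy, ENNReal.ofReal_of_nonpos hy, zero_add]
  rw [hsplit] at hfin ⊢
  obtain ⟨hp, hn⟩ := ENNReal.add_ne_top.1 hfin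
  rw [ENNReal.toReal_add hp hn]
  have hreal : ∀ {m₁ m₂ : Measure ℝ} (u : ℝ → ℝ≥0∞), m₁ ≤ m₂ + G →
      ∫⁻ y, u y ∂m₂ ≠ ⊤ → ∫⁻ y, u y ∂G ≠ ⊤ →
      (∫⁻ y, u y ∂m₁).toReal ≤ (∫⁻ y, u y ∂m₂).toReal + (∫⁻ y, u y ∂G).toReal := by
    intro m₁ m₂ u hm h2 hg
    rw [← ENNReal.toReal_add h2 hg]
    exact ENNReal.toReal_mono (ENNReal.add_ne_top.2 ⟨h2, hg⟩) (hlin u hm)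
  have f1 := hi.lintegral_lt_top.ne
  have f2 := hi₂.lintegral_lt_top.ne
  have g1 := hi.neg.lintegral_lt_top.ne
  have g2 := hi₂.neg.lintegral_lt_top.ne
  have e1 := hreal _ h12 f2 hp
  have e2 := hreal _ h21 f1 hp
  have e3 := hreal _ h12 g2 hn
  have e4 := hreal _ h21 g1 hn
  simp only [Pi.neg_apply] at e3 e4
  rw [abs_le]
  constructor <;> linarith

variable {Ω : Type*} [MeasurableSpace Ω] {P : Measure Ω} [IsProbabilityMeasure P] {X Y : Ω → ℝ}

/-- Concentration of the order statistic of rank `⌈α n⌉` at a point `v` near which the distribution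
function is within `b` of one that crosses the level `α` with slope at least `c`. -/
theorem measureReal_lt_abs_orderStat_sub_le (hX : Measurable X) {F₀ : ℝ → ℝ} {α b c v ρ₀ s : ℝ}
    (hb : ∀ t, |P.real {ω | X ω ≤ t} - F₀ t| ≤ b)
    (hgrow : ∀ s, 0 ≤ s → s < ρ₀ → α + c * s ≤ F₀ (v + s) ∧ F₀ (v - s) ≤ α - c * s)
    (hc : 0 < c) (hs0 : 0 ≤ s) (hs : s < ρ₀) (hbs : 2 * b ≤ c * s) {n : ℕ} (j : Fin n)
    (hj : (j : ℕ) ≤ α * n) (hj' : α * n ≤ (j : ℕ) + 1) :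
    (Measure.pi fun _ : Fin n => P).real
      {ω | s < |X (ω (Tuple.sort (fun i => X (ω i)) j)) - v|} ≤
      2 * Real.exp (-(n * c ^ 2 / 2) * s ^ 2) := by
  obtain ⟨h1, h2⟩ := hgrow s hs0 hs
  -- Half of the margin $cs$ absorbs the distribution function error $b\le cs/2$; the other half is
  -- the Hoeffding deviation.
  have hδ : 0 ≤ c * s / 2 := by positivity
  have hlow := measureReal_orderStat_le_le P hX j (t := v - s) hδ hj' (by
    have := abs_le.1 (hb (v - s)); linarith)
  have hup := measureReal_lt_orderStat_le P hX j (t := v + s) hδ hj (by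
    have := abs_le.1 (hb (v + s)); linarith)
  have hexp : (-2 : ℝ) * n * (c * s / 2) ^ 2 = -(n * c ^ 2 / 2) * s ^ 2 := by ring
  rw [hexp] at hlow hup
  refine le_trans (measureReal_mono (s₂ := {ω | X (ω (Tuple.sort (fun i => X (ω i)) j)) ≤ v - s} ∪
    {ω | v + s < X (ω (Tuple.sort (fun i => X (ω i)) j))}) ?_)
    ((measureReal_union_le _ _).trans (by linarith))
  intro ω hω
  simp only [Set.mem_ofPred_eq, Set.mem_union] at hω ⊢
  rcases lt_abs.1 hω with h | h
  · right; linarith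
  · left; linarith

/-- Integrate the tail probabilities. Up to $s=2b/c$, where the concentration bound is not
available, they are bounded by $1$; beyond that the tail is Gaussian with integral of order
$n^{-1/2}$. Truncating to the ball confines $s$ to the range where the growth of $F_0$ is known. -/
theorem integral_indicator_abs_orderStat_sub_le (hX : Measurable X) {F₀ : ℝ → ℝ}
    {α b c v ρ₀ ρ : ℝ} (hb0 : 0 ≤ b)
    (hb : ∀ t, |P.real {ω | X ω ≤ t} - F₀ t| ≤ b)
    (hgrow : ∀ s, 0 ≤ s → s < ρ₀ → α + c * s ≤ F₀ (v + s) ∧ F₀ (v - s) ≤ α - c * s)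
    (hc : 0 < c) (hρ : ρ ≤ ρ₀) {n : ℕ} (j : Fin n)
    (hj : (j : ℕ) ≤ α * n) (hj' : α * n ≤ (j : ℕ) + 1) :
    ∫ ω, (Metric.ball v ρ).indicator (fun t => |t - v|)
        (X (ω (Tuple.sort (fun i => X (ω i)) j))) ∂(Measure.pi fun _ : Fin n => P) ≤
      2 * b / c + √(2 * Real.pi) / c * (1 / √(n : ℝ)) := by
  have hn : 1 ≤ n := j.pos
  have hn' : (0 : ℝ) < n := by exact_mod_cast hn
  set A := 2 * b / c with hA
  have hA0 : 0 ≤ A := by positivity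
  set q : ℝ := n * c ^ 2 / 2 with hq
  have hq0 : 0 < q := by positivity
  set u : ℝ → ℝ := (Metric.ball v ρ).indicator fun t => |t - v| with hu
  have hum : Measurable u :=
    (by fun_prop : Measurable fun t : ℝ => |t - v|).indicator Metric.isOpen_ball.measurableSet
  have hu0 : ∀ t, 0 ≤ u t := fun t => Set.indicator_nonneg (fun _ _ => abs_nonneg _) t
  have hub : ∀ t s, 0 ≤ s → s < u t → s < ρ ∧ s < |t - v| := by
    intro t s hs hst
    by_cases ht : t ∈ Metric.ball v ρ
    · rw [hu, Set.indicator_of_mem ht] at hst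
      rw [Metric.mem_ball, Real.dist_eq] at ht
      exact ⟨hst.trans ht, hst⟩
    · rw [hu, Set.indicator_of_notMem ht] at hst
      exact absurd hst (not_lt.2 hs)
  have hui : Integrable (fun ω => u (X ω)) P := by
    refine (integrable_const |ρ|).mono' (hum.comp hX).aestronglyMeasurable
      (Eventually.of_forall fun ω => ?_)
    rw [Real.norm_of_nonneg (hu0 _)]
    by_contra hlt
    have h1 := hub (X ω) |ρ| (abs_nonneg _) (not_le.1 hlt)
    exact absurd h1.1 (not_lt.2 (le_abs_self _))
  have hTi := integrable_orderStat_concomitant P hX (hum.comp hX) hui j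
  have hlay := hTi.integral_eq_integral_meas_lt (Eventually.of_forall fun ω => hu0 _)
  simp only [Function.comp_apply] at hlay
  rw [hlay]
  have hg : IntegrableOn (fun s : ℝ => Real.exp (-q * s ^ 2)) (Set.Ioi 0) :=
    (integrable_exp_neg_mul_sq hq0).integrableOn
  have hI : IntegrableOn ((Set.Ioc 0 A).indicator fun _ => (1 : ℝ)) (Set.Ioi 0) :=
    ((integrable_indicator_iff measurableSet_Ioc).2
      (integrableOn_const (by simp))).integrableOn
  calc ∫ s in Set.Ioi 0, (Measure.pi fun _ : Fin n => P).real
        {ω | s < u (X (ω (Tuple.sort (fun i => X (ω i)) j)))}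
      ≤ ∫ s in Set.Ioi 0, ((Set.Ioc 0 A).indicator (fun _ => (1 : ℝ)) s +
          2 * Real.exp (-q * s ^ 2)) := by
        refine integral_mono_of_nonneg (Eventually.of_forall fun _ => measureReal_nonneg)
          (hI.add (hg.const_mul 2)) ?_
        filter_upwards [ae_restrict_mem measurableSet_Ioi] with s hs
        have hs' : (0 : ℝ) < s := hs
        have hexp : 0 < Real.exp (-q * s ^ 2) := Real.exp_pos _
        by_cases hsA : s ≤ A
        · rw [Set.indicator_of_mem (Set.mem_Ioc.2 ⟨hs', hsA⟩)]
          have : (Measure.pi fun _ : Fin n => P).real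
            {ω | s < u (X (ω (Tuple.sort (fun i => X (ω i)) j)))} ≤ 1 := measureReal_le_one
          linarith
        · rw [Set.indicator_of_notMem (fun hmem => hsA hmem.2), zero_add]
          by_cases hsρ : s < ρ
          · refine le_trans (measureReal_mono fun ω hω => (hub _ _ hs'.le hω).2)
              (measureReal_lt_abs_orderStat_sub_le hX hb hgrow hc hs'.le (hsρ.trans_le hρ) ?_ j
                hj hj')
            have := (not_le.1 hsA).le
            rw [hA, div_le_iff₀ hc] at this
            linarith
          · have : {ω : Fin n → Ω | s < u (X (ω (Tuple.sort (fun i => X (ω i)) j)))} = ∅ :=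
              Set.eq_empty_of_forall_notMem fun ω hω => hsρ (hub _ _ hs'.le hω).1
            rw [this, measureReal_empty]
            positivity
    _ = A + √(Real.pi / q) := by
        rw [integral_add hI (hg.const_mul 2), integral_const_mul, integral_gaussian_Ioi,
          setIntegral_indicator measurableSet_Ioc,
          Set.inter_eq_right.2 Set.Ioc_subset_Ioi_self]
        simp [hA0]
        ring
    _ = A + √(2 * Real.pi) / c * (1 / √(n : ℝ)) := by
        congr 1
        rw [hq, show Real.pi / (n * c ^ 2 / 2) = 2 * Real.pi / c ^ 2 / n by field_simp,
          Real.sqrt_div (by positivity), Real.sqrt_div (by positivity), Real.sqrt_sq hc.le]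
        ring

/-- Subtracting $Z=\mathbf 1_B(X)(Y-\gamma(X))$ does not change the mean at the selected index. On
the ball $B$ this leaves $\gamma(X)-w$, which `hw` controls. Off $B$ it leaves $Y-w$, which is paid
for by the escape probability and the second moment of $Y$. The parameter $\varepsilon$ balances
these two costs. -/
theorem abs_integral_orderStat_concomitant_sub_le (hX : Measurable X) (hYm : Measurable Y)
    (hY : Integrable Y P) (hY2 : Integrable (fun ω => Y ω ^ 2) P) {C : ℝ}
    (hC : ∫ ω, Y ω ^ 2 ∂P ≤ C) {γ : ℝ → ℝ} (hγ : IsRegression P Y X γ) {v ρ w e L : ℝ}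
    (he : 0 ≤ e)
    (hw : ∀ᵐ ω ∂P, X ω ∈ Metric.ball v ρ → |γ (X ω) - w| ≤ e + L * |X ω - v|)
    {n : ℕ} (j : Fin n) {ε : ℝ} (hε : 0 < ε) :
    |∫ ω, Y (ω (Tuple.sort (fun i => X (ω i)) j)) ∂(Measure.pi fun _ : Fin n => P) - w| ≤
      e + L * (∫ ω, (Metric.ball v ρ).indicator (fun t => |t - v|)
        (X (ω (Tuple.sort (fun i => X (ω i)) j))) ∂(Measure.pi fun _ : Fin n => P)) +
      (|w| + ε⁻¹ / 2) * (Measure.pi fun _ : Fin n => P).real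
        {ω | X (ω (Tuple.sort (fun i => X (ω i)) j)) ∉ Metric.ball v ρ} +
      ε / 2 * (n * C) := by
  set Q := Measure.pi fun _ : Fin n => P with hQ
  set T : (Fin n → Ω) → Fin n := fun ω => Tuple.sort (fun i => X (ω i)) j with hT
  set B := Metric.ball v ρ with hB
  have hBm : MeasurableSet B := Metric.isOpen_ball.measurableSet
  set u : ℝ → ℝ := B.indicator fun t => |t - v| with hu
  have hum : Measurable u := (by fun_prop : Measurable fun t : ℝ => |t - v|).indicator hBm
  have hub : ∀ t, |u t| ≤ |ρ| := by
    intro t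
    by_cases ht : t ∈ B
    · rw [hu, Set.indicator_of_mem ht, abs_abs]
      rw [hB, Metric.mem_ball, Real.dist_eq] at ht
      exact ht.le.trans (le_abs_self _)
    · rw [hu, Set.indicator_of_notMem ht, abs_zero]
      exact abs_nonneg _
  have hui : Integrable (fun ω => u (X ω)) P :=
    (integrable_const |ρ|).mono' (hum.comp hX).aestronglyMeasurable
      (Eventually.of_forall fun ω => hub _)
  set k : ℝ → ℝ := Bᶜ.indicator fun _ => (1 : ℝ) with hk
  have hkm : Measurable k := measurable_const.indicator hBm.compl
  have hki : Integrable (fun ω => k (X ω)) P := by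
    refine (integrable_const (1 : ℝ)).mono' (hkm.comp hX).aestronglyMeasurable
      (Eventually.of_forall fun ω => ?_)
    by_cases hω : X ω ∈ B <;> simp [hk, hω]
  set b : ℝ → ℝ := B.indicator fun _ => (1 : ℝ) with hb
  have hbm : Measurable b := measurable_const.indicator hBm
  have hbb : ∀ t, |b t| ≤ 1 := fun t => by by_cases ht : t ∈ B <;> simp [hb, ht]
  set Z : Ω → ℝ := fun ω => b (X ω) * (Y ω - γ (X ω)) with hZ
  have hZm : Measurable Z := (hbm.comp hX).mul (hYm.sub (hγ.measurable.comp hX))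
  have hZi : Integrable Z P := (hY.sub hγ.integrable).bdd_mul
    (hbm.comp hX).aestronglyMeasurable (Eventually.of_forall fun ω => hbb _)
  have hZ0 : ∫ ω, Z (ω (T ω)) ∂Q = 0 := by
    refine integral_orderStat_concomitant_eq_zero P hX hZi (fun c hc hcb => ?_) j
    obtain ⟨M, hM⟩ := hcb
    have := hγ.integral_eq_zero (fun t => c t * b t) (hc.mul hbm) ⟨M, fun t => by
      rw [abs_mul]
      exact (mul_le_of_le_one_right (abs_nonneg _) (hbb t)).trans (hM t)⟩
    rw [← this]
    refine integral_congr_ae (Eventually.of_forall fun ω => ?_)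
    simp only [hZ]
    ring
  have iY : Integrable (fun ω : Fin n → Ω => Y (ω (T ω))) Q :=
    integrable_orderStat_concomitant P hX hYm hY j
  have iZ : Integrable (fun ω : Fin n → Ω => Z (ω (T ω))) Q :=
    integrable_orderStat_concomitant P hX hZm hZi j
  have iu : Integrable (fun ω : Fin n → Ω => u (X (ω (T ω)))) Q :=
    integrable_orderStat_concomitant P hX (hum.comp hX) hui j
  have ik : Integrable (fun ω : Fin n → Ω => k (X (ω (T ω)))) Q :=
    integrable_orderStat_concomitant P hX (hkm.comp hX) hki j
  have iY2 : Integrable (fun ω : Fin n → Ω => Y (ω (T ω)) ^ 2) Q :=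
    integrable_orderStat_concomitant P hX (hYm.pow_const 2) hY2 j
  have hpt : ∀ᵐ ω ∂P, |Y ω - w - Z ω| ≤
      e + L * u (X ω) + (|w| + ε⁻¹ / 2) * k (X ω) + ε / 2 * Y ω ^ 2 := by
    filter_upwards [hw] with ω hω
    have hsq : 0 ≤ ε / 2 * Y ω ^ 2 := by positivity
    by_cases hm : X ω ∈ B
    · have h1 : b (X ω) = 1 := Set.indicator_of_mem hm _
      have h2 : k (X ω) = 0 := Set.indicator_of_notMem (Set.notMem_compl_iff.2 hm) _
      have h3 : u (X ω) = |X ω - v| := Set.indicator_of_mem hm _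
      simp only [hZ]
      rw [h1, h2, h3, show Y ω - w - 1 * (Y ω - γ (X ω)) = γ (X ω) - w by ring]
      have := hω hm
      linarith
    · have h1 : b (X ω) = 0 := Set.indicator_of_notMem hm _
      have h2 : k (X ω) = 1 := Set.indicator_of_mem hm _
      have h3 : u (X ω) = 0 := Set.indicator_of_notMem hm _
      simp only [hZ]
      rw [h1, h2, h3]
      have h4 : |Y ω - w - 0 * (Y ω - γ (X ω))| ≤ |Y ω| + |w| := by
        rw [zero_mul, sub_zero]
        exact abs_sub _ _
      -- Young's inequality, from $(\varepsilon|Y|-1)^2\ge0$.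
      have h5 : |Y ω| ≤ ε⁻¹ / 2 + ε / 2 * Y ω ^ 2 := by
        have h6 : 0 ≤ (ε * |Y ω| - 1) ^ 2 / (2 * ε) := by positivity
        have h7 : (ε * |Y ω| - 1) ^ 2 / (2 * ε) = ε⁻¹ / 2 + ε / 2 * |Y ω| ^ 2 - |Y ω| := by
          field_simp
          ring
        rw [sq_abs] at h7
        linarith
      linarith
  have hptQ : ∀ᵐ ω ∂Q, |Y (ω (T ω)) - w - Z (ω (T ω))| ≤
      e + L * u (X (ω (T ω))) + (|w| + ε⁻¹ / 2) * k (X (ω (T ω))) +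
        ε / 2 * Y (ω (T ω)) ^ 2 := by
    have : ∀ᵐ ω ∂Q, ∀ i : Fin n, |Y (ω i) - w - Z (ω i)| ≤
        e + L * u (X (ω i)) + (|w| + ε⁻¹ / 2) * k (X (ω i)) + ε / 2 * Y (ω i) ^ 2 :=
      ae_all_iff.2 fun i =>
        (measurePreserving_eval (fun _ : Fin n => P) i).quasiMeasurePreserving.ae hpt
    filter_upwards [this] with ω hω using hω _
  have hkq : ∫ ω, k (X (ω (T ω))) ∂Q = Q.real {ω | X (ω (T ω)) ∉ B} := by
    have hm : MeasurableSet {ω : Fin n → Ω | X (ω (T ω)) ∉ B} :=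
      measurable_orderStat_concomitant hX hX j hBm.compl
    have : (fun ω : Fin n → Ω => k (X (ω (T ω)))) =
        {ω | X (ω (T ω)) ∉ B}.indicator fun _ => (1 : ℝ) := by
      ext ω
      by_cases hω : X (ω (T ω)) ∈ B <;> simp [hk, hω]
    rw [this, integral_indicator_const _ hm, smul_eq_mul, mul_one]
  have hY2le := integral_orderStat_concomitant_le P hX (hYm.pow_const 2) hY2
    (fun ω => sq_nonneg _) j
  have hlhs : ∫ ω, Y (ω (T ω)) ∂Q - w = ∫ ω, (Y (ω (T ω)) - w - Z (ω (T ω))) ∂Q := by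
    have iYw : Integrable (fun ω : Fin n → Ω => Y (ω (T ω)) - w) Q := iY.sub (integrable_const w)
    rw [integral_sub iYw iZ, hZ0, integral_sub iY (integrable_const w)]
    simp
  rw [hlhs]
  have i1 : Integrable (fun ω : Fin n → Ω => e + L * u (X (ω (T ω)))) Q :=
    (integrable_const e).add (iu.const_mul L)
  have i2 : Integrable (fun ω : Fin n → Ω => e + L * u (X (ω (T ω))) +
      (|w| + ε⁻¹ / 2) * k (X (ω (T ω)))) Q := i1.add (ik.const_mul _)
  calc |∫ ω, (Y (ω (T ω)) - w - Z (ω (T ω))) ∂Q|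
      ≤ ∫ ω, |Y (ω (T ω)) - w - Z (ω (T ω))| ∂Q := abs_integral_le_integral_abs
    _ ≤ ∫ ω, (e + L * u (X (ω (T ω))) + (|w| + ε⁻¹ / 2) * k (X (ω (T ω))) +
          ε / 2 * Y (ω (T ω)) ^ 2) ∂Q :=
        integral_mono_of_nonneg (Eventually.of_forall fun _ => abs_nonneg _)
          (i2.add (iY2.const_mul _)) hptQ
    _ = e + L * (∫ ω, u (X (ω (T ω))) ∂Q) + (|w| + ε⁻¹ / 2) * Q.real {ω | X (ω (T ω)) ∉ B} +
          ε / 2 * ∫ ω, Y (ω (T ω)) ^ 2 ∂Q := by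
        rw [integral_add i2 (iY2.const_mul _), integral_add i1 (ik.const_mul _),
          integral_add (integrable_const e) (iu.const_mul L), integral_const_mul,
          integral_const_mul, integral_const_mul, hkq]
        simp
    _ ≤ _ := by
        gcongr
        exact hY2le.trans (by gcongr)

theorem abs_integral_orderStat_concomitant_sub_le_rate (hX : Measurable X) (hYm : Measurable Y)
    (hY : Integrable Y P) (hY2 : Integrable (fun ω => Y ω ^ 2) P) {C : ℝ}
    (hC : ∫ ω, Y ω ^ 2 ∂P ≤ C) {γ : ℝ → ℝ} (hγ : IsRegression P Y X γ) {F₀ : ℝ → ℝ}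
    {α b c v ρ₀ ρ w e L : ℝ} (he : 0 ≤ e) (hL : 0 ≤ L) (hb0 : 0 ≤ b)
    (hb : ∀ t, |P.real {ω | X ω ≤ t} - F₀ t| ≤ b)
    (hgrow : ∀ s, 0 ≤ s → s < ρ₀ → α + c * s ≤ F₀ (v + s) ∧ F₀ (v - s) ≤ α - c * s)
    (hc : 0 < c) (hρ0 : 0 < ρ) (hρ : ρ ≤ ρ₀) (hbρ : 4 * b ≤ c * ρ)
    (hw : ∀ᵐ ω ∂P, X ω ∈ Metric.ball v ρ → |γ (X ω) - w| ≤ e + L * |X ω - v|)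
    {n : ℕ} (j : Fin n) (hj : (j : ℕ) ≤ α * n) (hj' : α * n ≤ (j : ℕ) + 1) :
    |∫ ω, Y (ω (Tuple.sort (fun i => X (ω i)) j)) ∂(Measure.pi fun _ : Fin n => P) - w| ≤
      e + L * (2 * b / c + √(2 * Real.pi) / c * (1 / √(n : ℝ))) +
      (C / 2 + (4 * |w| + 2) / (c ^ 2 * ρ ^ 2 / 8) ^ 2) * (1 / √(n : ℝ)) := by
  have hn : 1 ≤ n := j.pos
  have hn1 : (1 : ℝ) ≤ n := by exact_mod_cast hn
  have hn' : (0 : ℝ) < n := by linarith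
  set r := √(n : ℝ) with hr
  have hr0 : 0 < r := Real.sqrt_pos.2 hn'
  have hrr : (n : ℝ) = r ^ 2 := (Real.sq_sqrt hn'.le).symm
  have hr1 : 1 ≤ r := Real.one_le_sqrt.2 hn1
  set k := c ^ 2 * ρ ^ 2 / 8 with hk
  have hk0 : 0 < k := by positivity
  -- With $\varepsilon=n^{-3/2}$ the second-moment term $\varepsilon nC/2$ is of order $n^{-1/2}$,
  -- and so is $\varepsilon^{-1}$ times an escape probability of order $n^{-2}$.
  have h1 := abs_integral_orderStat_concomitant_sub_le hX hYm hY hY2 hC hγ he hw j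
    (ε := 1 / r ^ 3) (by positivity)
  have h2 := integral_indicator_abs_orderStat_sub_le hX hb0 hb hgrow hc hρ j hj hj'
  have h3 : (Measure.pi fun _ : Fin n => P).real
      {ω | X (ω (Tuple.sort (fun i => X (ω i)) j)) ∉ Metric.ball v ρ} ≤ 4 / (k ^ 2 * r ^ 4) := by
    -- The radius is halved because leaving the open ball means $\rho\le|X-v|$ while the tail bound
    -- concerns a strict inequality, and because $s<\rho_0$ is needed. Thus $4b\le c\rho$ supplies
    -- $2b\le cs$.
    have h4 := measureReal_lt_abs_orderStat_sub_le hX hb hgrow hc (s := ρ / 2) (by positivity)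
      (by linarith) (by linarith) j hj hj'
    refine le_trans (measureReal_mono fun ω hω => ?_) (h4.trans ?_)
    · simp only [Set.mem_ofPred_eq, Metric.mem_ball, Real.dist_eq, not_lt] at hω ⊢
      linarith
    · have h5 : -(n * c ^ 2 / 2) * (ρ / 2) ^ 2 = -(k * r ^ 2) := by
        rw [hk, hrr]
        ring
      rw [h5, Real.exp_neg]
      -- The quadratic term of the exponential already gives the required decay $n^{-2}$.
      have h6 := Real.quadratic_le_exp_of_nonneg (x := k * r ^ 2) (by positivity)
      have h7 : (k * r ^ 2) ^ 2 / 2 ≤ Real.exp (k * r ^ 2) := by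
        have : 0 ≤ k * r ^ 2 := by positivity
        linarith
      have h8 : (Real.exp (k * r ^ 2))⁻¹ ≤ ((k * r ^ 2) ^ 2 / 2)⁻¹ :=
        inv_anti₀ (by positivity) h7
      calc 2 * (Real.exp (k * r ^ 2))⁻¹ ≤ 2 * ((k * r ^ 2) ^ 2 / 2)⁻¹ := by gcongr
        _ = 4 / (k ^ 2 * r ^ 4) := by field_simp; ring
  have h9 : (|w| + (1 / r ^ 3)⁻¹ / 2) * (Measure.pi fun _ : Fin n => P).real
      {ω | X (ω (Tuple.sort (fun i => X (ω i)) j)) ∉ Metric.ball v ρ} ≤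
      (4 * |w| + 2) / k ^ 2 * (1 / r) := by
    calc _ ≤ (|w| + (1 / r ^ 3)⁻¹ / 2) * (4 / (k ^ 2 * r ^ 4)) := by gcongr
      _ ≤ (|w| * r ^ 3 + r ^ 3 / 2) * (4 / (k ^ 2 * r ^ 4)) := by
          gcongr
          · exact le_mul_of_one_le_right (abs_nonneg _) (one_le_pow₀ hr1)
          · simp
      _ = (4 * |w| + 2) / k ^ 2 * (1 / r) := by field_simp; ring
  have h10 : 1 / r ^ 3 / 2 * (n * C) = C / 2 * (1 / r) := by
    rw [hrr]
    field_simp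
  rw [h10] at h1
  have h11 := mul_le_mul_of_nonneg_left h2 hL
  linarith

end Bias

/-! ### The bias of the nested estimator -/

section NestedEstimator

/-- Balls have positive Lebesgue measure. This fixes the value at the quantile of a version of the
conditional mean, which is a priori determined only almost everywhere. -/
theorem eq_of_ae_eq_of_continuousAt {g₁ g₂ : ℝ → ℝ} {v ρ : ℝ} (hρ : 0 < ρ)
    (h₁ : ContinuousAt g₁ v) (h₂ : ContinuousAt g₂ v)
    (hae : ∀ᵐ t, t ∈ Metric.ball v ρ → g₁ t = g₂ t) : g₁ v = g₂ v := by
  by_contra hne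
  obtain ⟨r, hr, hball⟩ := Metric.eventually_nhds_iff_ball.1 
    ((h₁.sub h₂).eventually_ne (sub_ne_zero.2 hne))
  have hsub : Metric.ball v (min r ρ) ⊆ {t | ¬ (t ∈ Metric.ball v ρ → g₁ t = g₂ t)} :=
    fun t ht hmem => hball t (Metric.ball_subset_ball (min_le_left _ _) ht)
      (sub_eq_zero.2 <| hmem (Metric.ball_subset_ball (min_le_right _ _) ht))
  exact (Metric.measure_ball_pos volume v (lt_min hr hρ)).ne'
    (measure_mono_null hsub (ae_iff.1 hae))

/-- Counted from zero the rank is $j=\lceil\alpha n\rceil-1$. The inequalities $j\le\alpha n\le j+1$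
are what the upper and the lower tail bound require. -/
theorem exists_rank {Θ Ξ : Type*} {h : ℝ → Ξ → ℝ} {α x : ℝ} (hα₀ : 0 < α) (hα₁ : α < 1) {n : ℕ} (hn : 1 ≤ n) :
    ∃ j : Fin n, ((j : ℕ) : ℝ) ≤ α * n ∧ α * n ≤ ((j : ℕ) : ℝ) + 1 ∧
      ∀ {m : ℕ} (ω : Fin n → Θ × (Fin m → Ξ)), phi h α x n m ω =
        Dhat h x (ω (Tuple.sort (fun i => Hhat h x (ω i).2) j)).2 := by
  have hn' : (0 : ℝ) < n := by exact_mod_cast hn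
  have hpos : 0 < ⌈α * n⌉₊ := Nat.ceil_pos.2 (by positivity)
  have hle : ⌈α * n⌉₊ ≤ n := Nat.ceil_le.2 (by nlinarith)
  have hk : ⌈α * n⌉₊ - 1 < n := by omega
  have hcast : ((⌈α * n⌉₊ - 1 : ℕ) : ℝ) = (⌈α * n⌉₊ : ℝ) - 1 := by
    rw [Nat.cast_sub hpos]; simp
  refine ⟨⟨⌈α * n⌉₊ - 1, hk⟩, ?_, ?_, fun ω => ?_⟩
  · have := Nat.ceil_lt_add_one (a := α * n) (by positivity)
    simp only [hcast]
    linarith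
  · have := Nat.le_ceil (α * n)
    simp only [hcast]
    linarith
  · rw [phi, dif_pos hk]

variable {Θ Ξ : Type*} [MeasurableSpace Θ] [MeasurableSpace Ξ]
  {μ : Measure Θ} {κ : Kernel Θ Ξ}
  {h : ℝ → Ξ → ℝ} {α x : ℝ} {𝒳 : Set ℝ} {f : ℝ → ℝ → ℝ} {G : ℕ → Measure ℝ}

/-- The ratio `-∂ₓF / f`, the continuous version of the regression function of the gradient. -/
def gradRatio (μ : Measure Θ) (κ : Kernel Θ Ξ) (h : ℝ → Ξ → ℝ) (f : ℝ → ℝ → ℝ) (x t : ℝ) : ℝ :=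
  -deriv (fun y => F μ κ h t y) x / f t x

theorem continuousAt_gradRatio (hx : x ∈ 𝒳) (h₃ : LocalDensityAssumption μ κ h α 𝒳 f)
    (hf : 0 < f (VaR μ κ h α x) x) :
    ContinuousAt (gradRatio μ κ h f x) (VaR μ κ h α x) := by
  obtain ⟨⟨δ, hδ, hfc, -, -⟩, -, hcont⟩ := h₃ x hx
  have h1 : ContinuousAt (fun t : ℝ => (t, x)) (VaR μ κ h α x) := by fun_prop
  have h2 : ContinuousAt (fun t => deriv (fun y => F μ κ h t y) x) (VaR μ κ h α x) :=
    ContinuousAt.comp_of_eq hcont h1 rfl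
  exact h2.neg.div (hfc.continuousAt (Metric.ball_mem_nhds _ hδ)) hf.ne'

variable [IsProbabilityMeasure μ] [IsMarkovKernel κ]

theorem integrable_phi (hα₀ : 0 < α) (hα₁ : α < 1) (hmeas : Measurable (h x))
    (hdmeas : Measurable (d h x)) (h₅ : SupremumAssumption μ κ h x) {n m : ℕ} (hn : 1 ≤ n)
    (hm : 1 ≤ m) : Integrable (phi h α x n m) (sampleLaw μ κ n m) := by
  obtain ⟨j, -, -, hj⟩ := exists_rank (Θ := Θ) (h := h) (x := x) hα₀ hα₁ hn
  obtain ⟨C, -, hC⟩ := exists_Dhat_sq_le hdmeas h₅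
  refine (integrable_orderStat_concomitant (pairLaw μ κ m) (measurable_Hhat hmeas m)
    (measurable_Dhat hdmeas m) (hC m hm).1 j).congr (Eventually.of_forall fun ω => ?_)
  exact (hj ω).symm

theorem exists_ae_eq_gradRatio (h𝒳 : IsOpen 𝒳) (hx : x ∈ 𝒳)
    (hmeas : ∀ y ∈ 𝒳, Measurable (h y)) (hL2 : ∀ᵐ θ ∂μ, MemLp (h x) 2 (κ θ))
    (h₂ : InterchangeAssumption μ κ h 𝒳) (hD : Integrable (D κ h x) μ)
    (h₃ : LocalDensityAssumption μ κ h α 𝒳 f) (hf : 0 < f (VaR μ κ h α x) x) {γ : ℝ → ℝ}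
    (hγ : IsRegression μ (D κ h x) (H κ h x) γ) :
    ∃ ρ > 0, ∀ᵐ t, t ∈ Metric.ball (VaR μ κ h α x) ρ → γ t = gradRatio μ κ h f x t := by
  obtain ⟨ρ₁, hρ₁, hae⟩ := ae_mul_density_eq_of_isRegression h𝒳 hx hmeas hL2 h₂ hD h₃ hγ
  obtain ⟨⟨δ, hδ, hfc, -, -⟩, -, -⟩ := h₃ x hx
  have hfpos := (hfc.continuousAt (Metric.ball_mem_nhds _ hδ)).eventually (lt_mem_nhds hf)
  obtain ⟨ρ₂, hρ₂, hpos⟩ := Metric.eventually_nhds_iff_ball.1 hfpos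
  refine ⟨min ρ₁ ρ₂, lt_min hρ₁ hρ₂, ?_⟩
  filter_upwards [hae] with t ht hmem
  have h1 := ht (Metric.ball_subset_ball (min_le_left _ _) hmem)
  have h2 := hpos t (Metric.ball_subset_ball (min_le_right _ _) hmem)
  rw [gradRatio, ← h1, mul_div_cancel_right₀ _ h2.ne']

/-- One estimate for both conclusions: $e$ small with $L=0$ gives convergence, and $e=0$ with $L$ a
Lipschitz constant at the quantile gives the rate. The threshold for $m$ does not depend on $n$, so
$n$ and $m$ may grow independently. -/
theorem exists_abs_meanPhi_sub_le (h𝒳 : IsOpen 𝒳) (hα₀ : 0 < α) (hα₁ : α < 1) (hx : x ∈ 𝒳)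
    (hmeas : ∀ y ∈ 𝒳, Measurable (h y)) (hdmeas : Measurable (d h x))
    (h₁ : MomentDensityAssumption μ κ h 𝒳) (h₂ : InterchangeAssumption μ κ h 𝒳)
    (h₃ : LocalDensityAssumption μ κ h α 𝒳 f) (hf : 0 < f (VaR μ κ h α x) x)
    (h₄ : MeasureAssumption μ κ h α x G) (h₅ : SupremumAssumption μ κ h x)
    (hD : Integrable (D κ h x) μ) :
    ∃ ρ₁ > 0, ∃ A : ℝ, ∀ ρ, 0 < ρ → ρ ≤ ρ₁ → ∀ w e L : ℝ, 0 ≤ e → 0 ≤ L →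
      (∀ᵐ t, t ∈ Metric.ball (VaR μ κ h α x) ρ →
        |gradRatio μ κ h f x t - w| ≤ e + L * |t - VaR μ κ h α x|) →
      ∃ B : ℝ, ∀ᶠ m : ℕ in atTop, ∀ n : ℕ, 1 ≤ n →
        |meanPhi μ κ h α x n m - w| ≤
          (absMoment (G m)).toReal + e + L * A * (1 / √(m : ℝ)) + B * (1 / √(n : ℝ)) := by
  obtain ⟨hL2, -, p, g₀, g₁, g₂, hdens, hmom⟩ := h₁ x hx
  obtain ⟨C₁, hC₁⟩ := hmom 1 zero_le_one (by norm_num)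
  obtain ⟨⟨η, hη, ν, νhat, hν, hνhat, hG⟩, hG0⟩ := h₄
  obtain ⟨c, hc, ρ₀, hρ₀, hgrow⟩ := exists_linear_growth_F hα₀ hα₁ hx hmeas h₃ hf
  obtain ⟨C, -, hC⟩ := exists_Dhat_sq_le (μ := μ) (κ := κ) hdmeas h₅
  have hH := measurable_H (κ := κ) (hmeas x hx)
  obtain ⟨ρ₂, hρ₂, hγ⟩ := exists_ae_eq_gradRatio h𝒳 hx hmeas hL2 h₂ hD h₃ hf
    (isRegression_of_isCondLaw hH hD hν)
  set v := VaR μ κ h α x with hv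
  set C₀ := max C₁ 0 with hC₀
  have hC₀0 : 0 ≤ C₀ := le_max_right _ _
  refine ⟨min ρ₀ (min ρ₂ η), by positivity, 4 * C₀ / c, fun ρ hρ hρ₁ w e L he hL hw => ?_⟩
  have hρρ₀ : ρ ≤ ρ₀ := hρ₁.trans (min_le_left _ _)
  have hρρ₂ : ρ ≤ ρ₂ := hρ₁.trans ((min_le_right _ _).trans (min_le_left _ _))
  have hρη : ρ ≤ η := hρ₁.trans ((min_le_right _ _).trans (min_le_right _ _))
  refine ⟨L * (√(2 * Real.pi) / c) + (C / 2 + (4 * |w| + 2) / (c ^ 2 * ρ ^ 2 / 8) ^ 2), ?_⟩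
  have hsqrt : Tendsto (fun m : ℕ => 2 * C₀ / √(m : ℝ)) atTop (𝓝 0) :=
    tendsto_const_nhds.div_atTop (Real.tendsto_sqrt_atTop.comp tendsto_natCast_atTop_atTop)
  have hcρ : 0 < c * ρ / 4 := by positivity
  -- For large $m$ the distribution function error $b=2C_0/\sqrt m$ satisfies $4b\le c\rho$, and
  -- $\int|y|\,dG_m$ is finite.
  filter_upwards [eventually_ge_atTop 1, hsqrt.eventually (gt_mem_nhds hcρ),
    hG0.eventually (gt_mem_nhds ENNReal.zero_lt_top)] with m hm hbρ hGm n hn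
  obtain ⟨-, hp0, hlaw, -, -, hg₀, -, -, -, hple⟩ := hdens m hm
  have hX := measurable_Hhat (Θ := Θ) (hmeas x hx) m
  have hb : ∀ t, |(pairLaw μ κ m).real {ω | Hhat h x ω.2 ≤ t} - F μ κ h t x| ≤
      2 * C₀ / √(m : ℝ) :=
    abs_cdf_Hhat_sub_F_le (hmeas x hx) hm hg₀ hlaw (fun u e => (hple u e).1) hC₀0 (by
      have := (hC₁ m hm).1
      simp_rw [Real.rpow_one] at this
      exact this.trans (ENNReal.ofReal_le_ofReal (le_max_left _ _)))
  have hac := map_Hhat_absolutelyContinuous (hmeas x hx) hm hlaw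
  have hγm := isRegression_of_isCondLaw hX (hC m hm).1 (hνhat m hm)
  have hae : ∀ᵐ ω ∂(pairLaw μ κ m), Hhat h x ω.2 ∈ Metric.ball v ρ →
      |∫ y, y ∂(νhat m (Hhat h x ω.2)) - w| ≤
        ((absMoment (G m)).toReal + e) + L * |Hhat h x ω.2 - v| := by
    have h1 := ae_integrable_of_isCondLaw hX (hC m hm).1 (hνhat m hm)
    have h2 : ∀ᵐ t ∂((pairLaw μ κ m).map fun ω => Hhat h x ω.2), t ∈ Metric.ball v ρ →
        |∫ y, y ∂(νhat m t) - w| ≤ ((absMoment (G m)).toReal + e) + L * |t - v| := by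
      -- Absolute continuity carries the Lebesgue-a.e. statements over to the law of $\hat H^m$. The
      -- mean of $\hat\nu^m(\cdot;t)$ is then compared with that of $\nu(\cdot;t)$, which is the
      -- gradient ratio at $t$.
      filter_upwards [h1, hac.ae_le hγ, hac.ae_le hw] with t hi h3 h4 hmem
      have := hν.1
      have := (hνhat m hm).1
      have h5 : |∫ y, y ∂(νhat m t) - ∫ y, y ∂(ν t)| ≤ (absMoment (G m)).toReal :=
        abs_integral_sub_integral_le (fun B hB => by
          rw [abs_sub_comm]
          exact hG m hm t (Metric.ball_subset_ball hρη hmem) B hB) hGm.ne hi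
      have h6 := h4 hmem
      rw [← h3 (Metric.ball_subset_ball hρρ₂ hmem)] at h6
      have h7 := abs_sub_le (∫ y, y ∂(νhat m t)) (∫ y, y ∂(ν t)) w
      linarith
    exact ae_of_ae_map hX.aemeasurable h2
  obtain ⟨j, hj, hj', hphi⟩ := exists_rank (Θ := Θ) (h := h) (x := x) hα₀ hα₁ hn
  have key := abs_integral_orderStat_concomitant_sub_le_rate hX (measurable_Dhat hdmeas m)
    (hC m hm).1 (hC m hm).2.1 (hC m hm).2.2 hγm (by positivity) hL (by positivity) hb hgrow hc
    hρ hρρ₀ (by linarith) hae j hj hj'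
  have hmean : meanPhi μ κ h α x n m =
      ∫ ω, Dhat h x (ω (Tuple.sort (fun i => Hhat h x (ω i).2) j)).2
        ∂(Measure.pi fun _ : Fin n => pairLaw μ κ m) := by
    unfold meanPhi sampleLaw
    simp_rw [hphi]
  rw [hmean]
  refine key.trans (le_of_eq ?_)
  field_simp
  ring

theorem tendsto_meanPhi_sub (h𝒳 : IsOpen 𝒳) (hα₀ : 0 < α) (hα₁ : α < 1) (hx : x ∈ 𝒳)
    (hmeas : ∀ y ∈ 𝒳, Measurable (h y)) (hdmeas : Measurable (d h x))
    (h₁ : MomentDensityAssumption μ κ h 𝒳) (h₂ : InterchangeAssumption μ κ h 𝒳)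
    (h₃ : LocalDensityAssumption μ κ h α 𝒳 f) (hf : 0 < f (VaR μ κ h α x) x)
    (h₄ : MeasureAssumption μ κ h α x G) (h₅ : SupremumAssumption μ κ h x)
    (hD : Integrable (D κ h x) μ) :
    Tendsto (fun nm : ℕ × ℕ => meanPhi μ κ h α x nm.1 nm.2 -
      gradRatio μ κ h f x (VaR μ κ h α x)) (atTop ×ˢ atTop) (𝓝 0) := by
  obtain ⟨ρ₁, hρ₁, A, hA⟩ :=
    exists_abs_meanPhi_sub_le h𝒳 hα₀ hα₁ hx hmeas hdmeas h₁ h₂ h₃ hf h₄ h₅ hD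
  set v := VaR μ κ h α x
  set w := gradRatio μ κ h f x v
  rw [Metric.tendsto_nhds]
  intro ε hε
  have hcont := continuousAt_gradRatio hx h₃ hf
  obtain ⟨ρ₂, hρ₂, hball⟩ := Metric.eventually_nhds_iff_ball.1
    (Metric.tendsto_nhds.1 hcont (ε / 3) (by positivity))
  -- One third of $\varepsilon$ goes to the continuity modulus of the gradient ratio; the other two
  -- go to $\int|y|\,dG_m$ and $B/\sqrt n$. With $L=0$ the $m^{-1/2}$ term disappears.
  obtain ⟨B, hB⟩ := hA (min ρ₁ ρ₂) (lt_min hρ₁ hρ₂) (min_le_left _ _) w (ε / 3) 0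
    (by positivity) le_rfl (Eventually.of_forall fun t ht => by
      rw [zero_mul, add_zero]
      exact (hball t (Metric.ball_subset_ball (min_le_right _ _) ht)).le)
  have hG : Tendsto (fun m => (absMoment (G m)).toReal) atTop (𝓝 0) := by
    have := (ENNReal.tendsto_toReal ENNReal.zero_ne_top).comp h₄.2
    simpa [Function.comp_def] using this
  have hn : Tendsto (fun n : ℕ => B * (1 / √(n : ℝ))) atTop (𝓝 0) := by
    have : Tendsto (fun n : ℕ => 1 / √(n : ℝ)) atTop (𝓝 0) :=
      tendsto_const_nhds.div_atTop (Real.tendsto_sqrt_atTop.comp tendsto_natCast_atTop_atTop)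
    simpa using this.const_mul B
  have e1 := (hn.eventually (gt_mem_nhds (show 0 < ε / 3 by positivity))).and
    (eventually_ge_atTop 1)
  have e2 := (hG.eventually (gt_mem_nhds (show 0 < ε / 3 by positivity))).and hB
  filter_upwards [e1.prod_mk e2] with nm hnm
  obtain ⟨⟨h3, h4⟩, h5, h6⟩ := hnm
  have := h6 nm.1 h4
  rw [Real.dist_eq, sub_zero]
  linarith

theorem isBigO_meanPhi_sub (h𝒳 : IsOpen 𝒳) (hα₀ : 0 < α) (hα₁ : α < 1) (hx : x ∈ 𝒳)
    (hmeas : ∀ y ∈ 𝒳, Measurable (h y)) (hdmeas : Measurable (d h x))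
    (h₁ : MomentDensityAssumption μ κ h 𝒳) (h₂ : InterchangeAssumption μ κ h 𝒳)
    (h₃ : LocalDensityAssumption μ κ h α 𝒳 f) (hf : 0 < f (VaR μ κ h α x) x)
    (h₄ : MeasureAssumption μ κ h α x G) (h₅ : SupremumAssumption μ κ h x)
    (hD : Integrable (D κ h x) μ)
    (hG : ∃ C : ℝ, ∀ᶠ m : ℕ in atTop,
      absMoment (G m) ≤ ENNReal.ofReal (C * (m : ℝ) ^ (-(1 / 2) : ℝ)))
    {g : ℝ → ℝ} (hg : IsCondMean μ κ h x g) (hgd : DifferentiableAt ℝ g (VaR μ κ h α x))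
    {n m : ℕ → ℕ} (hn : Tendsto n atTop atTop) (hm : Tendsto m atTop atTop)
    (hnm : (fun k => (n k : ℝ)) =Θ[atTop] (fun k => (m k : ℝ))) :
    (fun k => meanPhi μ κ h α x (n k) (m k) - gradRatio μ κ h f x (VaR μ κ h α x))
      =O[atTop] (fun k => (n k : ℝ) ^ (-(1 / 2) : ℝ)) := by
  obtain ⟨ρ₁, hρ₁, A, hA⟩ :=
    exists_abs_meanPhi_sub_le h𝒳 hα₀ hα₁ hx hmeas hdmeas h₁ h₂ h₃ hf h₄ h₅ hD
  obtain ⟨ρ₂, hρ₂, hgae⟩ := exists_ae_eq_gradRatio h𝒳 hx hmeas (h₁ x hx).1 h₂ hD h₃ hf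
    (isRegression_of_isCondMean (measurable_H (hmeas x hx)) hD hg)
  -- Both $g$ and the gradient ratio are continuous at the quantile, so their a.e. equality holds at
  -- that point. The linear bound for $g$ there then becomes an a.e. linear bound for the gradient
  -- ratio around $w$.
  have hgv := eq_of_ae_eq_of_continuousAt hρ₂ hgd.continuousAt (continuousAt_gradRatio hx h₃ hf)
    hgae
  set v := VaR μ κ h α x
  set w := gradRatio μ κ h f x v
  obtain ⟨L, hL, hLip⟩ := hgd.isBigO_sub.exists_nonneg
  obtain ⟨ρ₃, hρ₃, hball⟩ := Metric.eventually_nhds_iff_ball.1 hLip.bound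
  have hr : 0 < min ρ₁ (min ρ₂ ρ₃) := lt_min hρ₁ (lt_min hρ₂ hρ₃)
  obtain ⟨B, hB⟩ := hA _ hr (min_le_left _ _) w 0 L le_rfl hL (by
    filter_upwards [hgae] with t ht hmem
    have h1 := hball t (Metric.ball_subset_ball
      ((min_le_right _ _).trans (min_le_right _ _)) hmem)
    rw [hgv, ht (Metric.ball_subset_ball ((min_le_right _ _).trans (min_le_left _ _)) hmem)] at h1
    rw [zero_add]
    exact h1)
  obtain ⟨C, hC⟩ := hG
  have hsq : ∀ k : ℕ, 1 / √(k : ℝ) = (k : ℝ) ^ (-(1 / 2) : ℝ) := fun k => by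
    rw [Real.sqrt_eq_rpow, Real.rpow_neg (Nat.cast_nonneg k), one_div]
  -- Only $n=O(m)$ is needed to turn $m^{-1/2}$ into $O(n^{-1/2})$. Inverting the comparison
  -- requires $n\neq0$, which holds eventually.
  have hmn : (fun k => (m k : ℝ) ^ (-(1 / 2) : ℝ)) =O[atTop]
      fun k => (n k : ℝ) ^ (-(1 / 2) : ℝ) := by
    have h1 := hnm.1.rpow (r := 1 / 2) (by norm_num) (Eventually.of_forall fun k =>
      (Nat.cast_nonneg (m k) : (0 : ℝ) ≤ m k))
    have h2 := h1.inv_rev (by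
      filter_upwards [hn.eventually_ge_atTop 1] with k hk h0
      have : (0 : ℝ) < n k := by exact_mod_cast hk
      exact absurd h0 (Real.rpow_pos_of_pos this _).ne')
    refine (h2.congr (fun k => ?_) fun k => ?_) <;>
      exact (Real.rpow_neg (Nat.cast_nonneg _) _).symm
  have hmain : (fun k => meanPhi μ κ h α x (n k) (m k) - w) =O[atTop]
      fun k => (|C| + L * A) * (m k : ℝ) ^ (-(1 / 2) : ℝ) +
        B * (n k : ℝ) ^ (-(1 / 2) : ℝ) := by
    refine IsBigO.of_bound 1 ?_
    filter_upwards [hm.eventually hB, hm.eventually hC, hn.eventually_ge_atTop 1] with k h3 h4 h5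
    have h6 := h3 (n k) h5
    have h7 : (absMoment (G (m k))).toReal ≤ |C| * (m k : ℝ) ^ (-(1 / 2) : ℝ) :=
      ENNReal.toReal_le_of_le_ofReal (by positivity) (h4.trans (ENNReal.ofReal_le_ofReal
        (mul_le_mul_of_nonneg_right (le_abs_self C) (by positivity))))
    rw [hsq, hsq] at h6
    rw [one_mul, Real.norm_eq_abs, Real.norm_eq_abs]
    refine le_trans ?_ (le_abs_self _)
    linarith
  exact hmain.trans ((hmn.const_mul_left _).add ((isBigO_refl _ _).const_mul_left _))

end NestedEstimator

end NestedVaR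

end

open NestedVaR in
theorem mainTheorem2 {Θ Ξ : Type*} [MeasurableSpace Θ] [MeasurableSpace Ξ]
    (μ : Measure Θ) [IsProbabilityMeasure μ] (κ : Kernel Θ Ξ) [IsMarkovKernel κ]
    (h : ℝ → Ξ → ℝ) (𝒳 : Set ℝ) (h𝒳 : IsOpen 𝒳)
    (α : ℝ) (hα₀ : 0 < α) (hα₁ : α < 1) (x : ℝ) (hx : x ∈ 𝒳)
    (hmeas : ∀ y ∈ 𝒳, Measurable (h y)) (hdmeas : Measurable (d h x))
    (f : ℝ → ℝ → ℝ) (G : ℕ → Measure ℝ)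
    (h₁ : MomentDensityAssumption μ κ h 𝒳)
    (h₂ : InterchangeAssumption μ κ h 𝒳)
    (h₃ : LocalDensityAssumption μ κ h α 𝒳 f)
    (hf : 0 < f (VaR μ κ h α x) x)
    (h₄ : MeasureAssumption μ κ h α x G)
    (h₅ : SupremumAssumption μ κ h x) :
    DifferentiableAt ℝ (VaR μ κ h α) x ∧
    (∀ n m : ℕ, 1 ≤ n → 1 ≤ m → Integrable (phi h α x n m) (sampleLaw μ κ n m)) ∧
    Tendsto (fun nm : ℕ × ℕ => meanPhi μ κ h α x nm.1 nm.2 - deriv (VaR μ κ h α) x)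
      (atTop ×ˢ atTop) (𝓝 0) ∧
    ((∃ C : ℝ, ∀ᶠ m : ℕ in atTop,
          absMoment (G m) ≤ ENNReal.ofReal (C * (m : ℝ) ^ (-(1 / 2) : ℝ))) →
      (∃ g : ℝ → ℝ, IsCondMean μ κ h x g ∧ DifferentiableAt ℝ g (VaR μ κ h α x)) →
      ∀ n m : ℕ → ℕ, Tendsto n atTop atTop → Tendsto m atTop atTop →
        (fun k => (n k : ℝ)) =Θ[atTop] (fun k => (m k : ℝ)) →
        (fun k => meanPhi μ κ h α x (n k) (m k) - deriv (VaR μ κ h α) x)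
          =O[atTop] (fun k => (n k : ℝ) ^ (-(1 / 2) : ℝ))) := by
  have hL2 := (h₁ x hx).1
  have hD : Integrable (D κ h x) μ := by
    obtain ⟨M, hM⟩ := exists_ae_abs_D_le h𝒳 hx hmeas hdmeas hL2 h₂ h₅
    exact (integrable_const M).mono' (aestronglyMeasurable_D h𝒳 hx hmeas hdmeas hL2 h₂) hM
  have hV := hasDerivAt_VaR h𝒳 hα₀ hα₁ hx hmeas h₃ hf
  -- The implicit function formula for $v_\alpha'(x)$ is exactly the gradient ratio at the quantile,
  -- the value around which the bias of the estimator has been bounded.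
  have hV' : deriv (VaR μ κ h α) x = gradRatio μ κ h f x (VaR μ κ h α x) := hV.deriv
  rw [hV']
  refine ⟨hV.differentiableAt, fun n m hn hm =>
    integrable_phi hα₀ hα₁ (hmeas x hx) hdmeas h₅ hn hm, ?_, ?_⟩
  · exact tendsto_meanPhi_sub h𝒳 hα₀ hα₁ hx hmeas hdmeas h₁ h₂ h₃ hf h₄ h₅ hD
  · rintro hG ⟨g, hg, hgd⟩ n m hn hm hnm
    exact isBigO_meanPhi_sub h𝒳 hα₀ hα₁ hx hmeas hdmeas h₁ h₂ h₃ hf h₄ h₅ hD hG hg hgd hn hm hnm
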